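/- Let $R\ge 1$ and $L\ge 2$, let $u_1,\dots,u_{2R}$ be integers, and let $D=\mathrm{diag}\big(e^{2\pi \mathrm{j} u_1/L},\dots,e^{2\pi \mathrm{j} u_{2R}/L}\big)$, $\mathrm{j}=\sqrt{-1}$, be the generator of the cyclic group used at the source. Let $M$ be an $R\times R$ complex matrix with all entries of modulus one and $MM^H=M^HM=R\,I_R$, let $\Gamma=\begin{bmatrix}M\\ M\end{bmatrix}$, $x=\frac1{\sqrt{2R}}(1,\dots,1)^T\in\mathbb C^{2R}$, and let $A_j=\mathrm{diag}(\Gamma_{1j},\dots,\Gamma_{2R,j})$ for $j=1,\dots,R$. The codewords are $S_k=[A_1D^kx\ \cdots\ A_RD^kx]=\frac1{\sqrt{2R}}D^k\Gamma$, $k=1,\dots,L$. A source communicates with a destination through $R$ relays. For a message $k$, uniformly distributed on $\{1,\dots,L\}$, the source sends $s=D^kx$, relay $j$ receives $r_j=\sqrt{2RP_1}\,f_j s+n_j$ and transmits $t_j=\sqrt{P_2/(1+P_1)}\,A_jr_j$, and the destination receives $y=\sum_{j=1}^R g_jt_j+w$. Here $f_j,g_j$ and all coordinates of $n_j,w\in\mathbb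 C^{2R}$ are independent circularly symmetric complex Gaussian variables with mean $0$ and variance $1$, independent of the message. The total power is $P=P_1+RP_2$, split in fixed proportions: $P_1=\alpha P$ and $P_2=(1-\alpha)P/R$ with $0<\alpha<1$. The destination knows $g=(g_1,\dots,g_R)$ but not the $f_j$, and uses a maximum likelihood decoder: it outputs, as a measurable function of $(g,y)$, a message $\hat k$ that maximizes the conditional density of $y$ given $(S_k,g)$, ties being broken arbitrarily. The network has diversity order $d$ if the block error probability $P_e(P)=\Pr[\hat k\ne k]$ satisfies $\lim_{P\to\infty}-\log P_e(P)/\log P=d$. Then the network has diversity order $R$ if and only if $$\gcd(u_i-u_{R+i},\,L)=1\qquad\text{for each } i=1,\dots,R .$$ The same condition is also necessary and sufficient for the determinant criterion for full diversity: $\det\big([S_n\ S_m]^H[S_n\ S_m]\big)\neq0$ for all $n\ne m$ in $\{1,\dots,L\}$. -/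

import Mathlib

open scoped Matrix

namespace RelayNetwork

noncomputable section

/-- The index set `{1, …, 2R}` of the `T = 2R` channel uses, split into its two halves:
`Sum.inl i` is the position `i` and `Sum.inr i` is the position `R + i`, for `i : Fin R`. -/
abbrev Slot (R : ℕ) : Type := Fin R ⊕ Fin R

/-! ### The code -/

/-- Generalized Butson-Hadamard matrices of size `R`. -/
structure IsGBH {R : ℕ} (M : Matrix (Fin R) (Fin R) ℂ) : Prop where
  mul_conjTranspose : M * Mᴴ = (R : ℂ) • (1 : Matrix (Fin R) (Fin R) ℂ)
  conjTranspose_mul : Mᴴ * M = (R : ℂ) • (1 : Matrix (Fin R) (Fin R) ℂ)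
  star_mul_self : ∀ i j, star (M i j) * M i j = 1

/-- The generator `D = diag (exp (2 π √-1 u_i / L))` of the cyclic group at the source. -/
def generator {R : ℕ} (L : ℕ) (u : Slot R → ℤ) : Matrix (Slot R) (Slot R) ℂ :=
  Matrix.diagonal fun i => Complex.exp (2 * Real.pi * Complex.I * (u i : ℂ) / (L : ℂ))

/-- The vector `x = (2R)^{-1/2} (1, …, 1)`. -/
def initialVector (R : ℕ) : Slot R → ℂ := fun _ => ((1 / Real.sqrt (2 * R) : ℝ) : ℂ)

/-- The `2R × R` matrix `Γ` whose upper and lower halves are both `M`. -/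
def stacked {R : ℕ} (M : Matrix (Fin R) (Fin R) ℂ) : Matrix (Slot R) (Fin R) ℂ :=
  Matrix.fromRows M M

/-- The diagonal matrix `A_j` of the `j`-th relay, built from the `j`-th column of `Γ`. -/
def relayMatrix {R : ℕ} (M : Matrix (Fin R) (Fin R) ℂ) (j : Fin R) :
    Matrix (Slot R) (Slot R) ℂ :=
  Matrix.diagonal fun i => stacked M i j

/-- The vector `D^k x` sent by the source for the message `k`. The messages `0, …, L - 1` of
`Fin L` stand for the exponents `1, …, L`. -/
def sourceVector {R L : ℕ} (u : Slot R → ℤ) (k : Fin L) : Slot R → ℂ :=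
  (generator L u ^ ((k : ℕ) + 1)) *ᵥ initialVector R

/-- The codeword matrix `S_k = [A_1 D^k x  …  A_R D^k x]`. -/
def codeword {R L : ℕ} (u : Slot R → ℤ) (M : Matrix (Fin R) (Fin R) ℂ) (k : Fin L) :
    Matrix (Slot R) (Fin R) ℂ :=
  Matrix.of fun i j => (relayMatrix M j *ᵥ sourceVector u k) i

/-- The design criterion: `|S_{nm}ᴴ S_{nm}| ≠ 0` for all `n ≠ m`, with `S_{nm} = [S_n  S_m]`. -/
def MeetsDeterminantCriterion {R L : ℕ} (S : Fin L → Matrix (Slot R) (Fin R) ℂ) : Prop :=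
  ∀ n m : Fin L, n ≠ m →
    ((Matrix.fromCols (S n) (S m))ᴴ * Matrix.fromCols (S n) (S m)).det ≠ 0

/-! ### The channel -/

/-- The circularly symmetric complex Gaussian law with mean `0` and variance `1`. -/
def cscg : MeasureTheory.Measure ℂ :=
  MeasureTheory.volume.withDensity fun z => ENNReal.ofReal (Real.pi⁻¹ * Real.exp (-‖z‖ ^ 2))

instance : MeasureTheory.IsProbabilityMeasure cscg := by
  constructor
  have h : ∫ z : ℂ, Real.exp (-1 * ‖z‖ ^ 2) = Real.pi := by
    have := GaussianFourier.integral_rexp_neg_mul_sq_norm (V := ℂ) (b := 1) one_pos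
    simpa [Complex.finrank_real_complex] using this
  have hi : MeasureTheory.Integrable (fun z : ℂ => Real.exp (-1 * ‖z‖ ^ 2)) := by
    by_contra hn
    rw [MeasureTheory.integral_undef hn] at h
    exact Real.pi_ne_zero h.symm
  rw [cscg, MeasureTheory.withDensity_apply _ MeasurableSet.univ,
    MeasureTheory.Measure.restrict_univ,
    ← MeasureTheory.ofReal_integral_eq_lintegral_ofReal]
  · rw [MeasureTheory.integral_const_mul]
    simp only [neg_mul, one_mul] at h
    rw [h, inv_mul_cancel₀ Real.pi_ne_zero, ENNReal.ofReal_one]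
  · simpa using hi.const_mul Real.pi⁻¹
  · exact Filter.Eventually.of_forall fun z => by positivity

/-- One realization `(f, g, n, w)` of the randomness in the network: the fading coefficients
`f_j` (source to relays) and `g_j` (relays to destination), the noise vectors `n_j` at the relays
and the noise vector `w` at the destination. -/
abbrev Realization (R : ℕ) : Type :=
  (Fin R → ℂ) × (Fin R → ℂ) × (Fin R → Slot R → ℂ) × (Slot R → ℂ)

/-- All coordinates of `f, g, n, w` are independent with law `cscg`. -/
def channelLaw (R : ℕ) : MeasureTheory.Measure (Realization R) :=
  (MeasureTheory.Measure.pi fun _ => cscg).prod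
    ((MeasureTheory.Measure.pi fun _ => cscg).prod
      ((MeasureTheory.Measure.pi fun _ => MeasureTheory.Measure.pi fun _ => cscg).prod
        (MeasureTheory.Measure.pi fun _ => cscg)))

/-- The vector `r_j = √(P₁ T) f_j s + n_j` received by the `j`-th relay, with `T = 2R`. -/
def relayReceived {R : ℕ} (P₁ : ℝ) (s : Slot R → ℂ) (f : Fin R → ℂ) (n : Fin R → Slot R → ℂ)
    (j : Fin R) : Slot R → ℂ :=
  ((Real.sqrt (P₁ * (2 * R)) : ℂ) * f j) • s + n j

/-- The vector `t_j = √(P₂ / (1 + P₁)) A_j r_j` transmitted by a relay with matrix `A_j`. -/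
def relayTransmitted {R : ℕ} (P₁ P₂ : ℝ) (A : Matrix (Slot R) (Slot R) ℂ) (r : Slot R → ℂ) :
    Slot R → ℂ :=
  (Real.sqrt (P₂ / (1 + P₁)) : ℂ) • (A *ᵥ r)

/-- The vector `y = ∑_j g_j t_j + w` received by the destination when the message is `k`. -/
def received {R L : ℕ} (u : Slot R → ℤ) (M : Matrix (Fin R) (Fin R) ℂ) (P₁ P₂ : ℝ) (k : Fin L)
    (ω : Realization R) : Slot R → ℂ :=
  match ω with
  | (f, g, n, w) =>
    ∑ j, g j • relayTransmitted P₁ P₂ (relayMatrix M j)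
      (relayReceived P₁ (sourceVector u k) f n j) + w

/-! ### Maximum likelihood decoding -/

/-- `Σ_y = ρ S diag(|g_1|², …, |g_R|²) Sᴴ + γ I`, where `ρ = P₁ P₂ T / (1 + P₁)`, `T = 2R`, and
`γ = 1 + P₂ / (1 + P₁) ∑_j |g_j|²`: the conditional covariance of `y` given `S` and `g`. -/
def covariance {R : ℕ} (P₁ P₂ : ℝ) (S : Matrix (Slot R) (Fin R) ℂ) (g : Fin R → ℂ) :
    Matrix (Slot R) (Slot R) ℂ :=
  ((P₁ * P₂ * (2 * R) / (1 + P₁) : ℝ) : ℂ) •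
      (S * Matrix.diagonal (fun j => ((‖g j‖ ^ 2 : ℝ) : ℂ)) * Sᴴ) +
    ((1 + P₂ / (1 + P₁) * ∑ j, ‖g j‖ ^ 2 : ℝ) : ℂ) • (1 : Matrix (Slot R) (Slot R) ℂ)

/-- The conditional probability density of the received vector `y` given `S` and `g`
(the determinant and the quadratic form are real). -/
def likelihood {R : ℕ} (P₁ P₂ : ℝ) (S : Matrix (Slot R) (Fin R) ℂ) (g : Fin R → ℂ)
    (y : Slot R → ℂ) : ℝ :=
  (Real.pi ^ (2 * R) * (covariance P₁ P₂ S g).det.re)⁻¹ *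
    Real.exp (-(star y ⬝ᵥ ((covariance P₁ P₂ S g)⁻¹ *ᵥ y)).re)

/-- `dec` is a partially coherent maximum likelihood decoder: from `g` and `y` (but not `f`) it
computes, measurably, a message that maximizes the likelihood. Ties are broken arbitrarily. -/
structure IsMLDecoder {R L : ℕ} (u : Slot R → ℤ) (M : Matrix (Fin R) (Fin R) ℂ) (P₁ P₂ : ℝ)
    (dec : (Fin R → ℂ) → (Slot R → ℂ) → Fin L) : Prop where
  measurable : Measurable fun z : (Fin R → ℂ) × (Slot R → ℂ) => dec z.1 z.2
  isMax : ∀ g y (k : Fin L),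
    likelihood P₁ P₂ (codeword u M k) g y ≤ likelihood P₁ P₂ (codeword u M (dec g y)) g y

/-- The block error probability of the decoder `dec`, for equiprobable messages. -/
def blockErrorProb {R L : ℕ} (u : Slot R → ℤ) (M : Matrix (Fin R) (Fin R) ℂ) (P₁ P₂ : ℝ)
    (dec : (Fin R → ℂ) → (Slot R → ℂ) → Fin L) : ℝ :=
  (1 / L : ℝ) * ∑ k : Fin L,
    (channelLaw R).real {ω | dec ω.2.1 (received u M P₁ P₂ k ω) ≠ k}

/-- An error probability, as a function of the total power `P`, has diversity order `d` if it
decays like `P ^ (-d + o(1))` as `P → ∞`. -/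
def HasDiversityOrder (Pe : ℝ → ℝ) (d : ℝ) : Prop :=
  Filter.Tendsto (fun P => -Real.log (Pe P) / Real.log P) Filter.atTop (nhds d)

end

end RelayNetwork

namespace RelayNetwork

noncomputable section

/-! ### The code -/

/-! Slots `i` and `R + i` carry the same row of `M`, so `S_n a + S_m b = 0` decouples into one `2 ×
2` system for each `i`, with unknowns `(M a)_i`, `(M b)_i` and phases as coefficients. Its
determinant vanishes exactly when `L ∣ (u_i - u_{R+i})(n - m)`. Coprimality excludes this for `n ≠
m`, and `M` is invertible, so `[S_n S_m]` is invertible (`det_fromCols_ne_zero`). If the gcd is `d >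
1`, exponents differing by `L / d` and the conjugated row `a` of `M` give `S_n a = z S_m a` with
`|z| = 1` (`exists_codeword_mulVec_eq`). This settles the determinant criterion.

Upper bound on the error. All covariances have the same determinant, so the decoder compares
quadratic forms. If it prefers `m` to the true `k`, the form of `m` is at most a noise term. Writing
`y` in two ways and inverting `[S_k S_m]` bounds every `gain * |f_j g_j|` by a constant times a
noise quantity (`exists_gain_mul_le`). Raising this to a power `s < 2`, multiplying over `j` and
applying Markov's inequality (`exists_errorProb_le`) gives an error of order at most `gain ^ (-s
R)`. Negative moments of order below `2` of a complex Gaussian are finite, and `gain ^ 2` is of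
order `P`; letting `s → 2` yields every exponent below `R`.

Lower bound on the error. Two means at bounded distance cannot be separated in Gaussian noise
(`exists_two_point_bound`). If all `f_j` are of order `P ^ (-1/2)`, an event of probability of order
`P ^ (-R)`, every two messages are confused, so the order never exceeds `R`. If a gcd is not `1`,
the law of `f` is invariant under `f ↦ z f`, so `n` and `m` are already confused when `(f_j g_j)` is
within `P ^ (-1/2)` of the line spanned by `a`. That constrains only `R - 1` coordinates and has
probability at least of order `P ^ (1 - R)`, which contradicts order `R`. -/

/-- The `i`-th diagonal entry of the generator. -/
def phase {R : ℕ} (L : ℕ) (u : Slot R → ℤ) (i : Slot R) : ℂ :=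
  Complex.exp (2 * Real.pi * Complex.I * (u i : ℂ) / (L : ℂ))

theorem norm_phase {R : ℕ} (L : ℕ) (u : Slot R → ℤ) (i : Slot R) : ‖phase L u i‖ = 1 := by
  have : 2 * Real.pi * Complex.I * (u i : ℂ) / (L : ℂ)
      = ((2 * Real.pi * u i / L : ℝ) : ℂ) * Complex.I := by
    push_cast; ring
  rw [phase, this, Complex.norm_exp_ofReal_mul_I]

theorem phase_ne_zero {R : ℕ} (L : ℕ) (u : Slot R → ℤ) (i : Slot R) : phase L u i ≠ 0 :=
  Complex.exp_ne_zero _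

/-- For paired slots, this is the vanishing of the `2 × 2` determinant to which the singularity of
`[S_n S_m]` reduces. -/
theorem phase_mul_pow_eq_iff {R L : ℕ} (hL : L ≠ 0) (u : Slot R → ℤ) (i j : Slot R) (n m : ℕ) :
    phase L u i ^ n * phase L u j ^ m = phase L u i ^ m * phase L u j ^ n ↔
      (L : ℤ) ∣ (u i - u j) * ((n : ℤ) - m) := by
  have hL' : (L : ℂ) ≠ 0 := by exact_mod_cast hL
  have hpi : (2 * Real.pi * Complex.I : ℂ) ≠ 0 := Complex.two_pi_I_ne_zero
  simp only [phase, ← Complex.exp_nat_mul, ← Complex.exp_add]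
  rw [Complex.exp_eq_exp_iff_exists_int]
  constructor
  · rintro ⟨k, hk⟩
    refine ⟨k, ?_⟩
    have : (2 * Real.pi * Complex.I) * (((u i - u j) * ((n : ℤ) - m) : ℤ) : ℂ)
        = (2 * Real.pi * Complex.I) * ((L * k : ℤ) : ℂ) := by
      push_cast
      field_simp at hk
      linear_combination (2 * Real.pi * Complex.I : ℂ) * hk
    exact_mod_cast mul_left_cancel₀ hpi this
  · rintro ⟨k, hk⟩
    refine ⟨k, ?_⟩
    have : (((u i - u j) * ((n : ℤ) - m) : ℤ) : ℂ) = ((L * k : ℤ) : ℂ) := by rw [hk]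
    push_cast at this
    field_simp
    linear_combination this

/-- The scale `(2R)^{-1/2}` of the codewords. -/
def amp (R : ℕ) : ℂ := ((1 / Real.sqrt (2 * R) : ℝ) : ℂ)

theorem amp_ne_zero {R : ℕ} (hR : 1 ≤ R) : amp R ≠ 0 := by
  have : (0 : ℝ) < 2 * R := by positivity
  simp only [amp, ne_eq, Complex.ofReal_eq_zero]
  positivity

theorem norm_amp_le {R : ℕ} (hR : 1 ≤ R) : ‖amp R‖ ≤ 1 := by
  have h1 : (1 : ℝ) ≤ R := by exact_mod_cast hR
  rw [amp, Complex.norm_real, Real.norm_of_nonneg (by positivity),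
    div_le_one (by positivity), Real.one_le_sqrt]
  linarith

theorem sourceVector_apply {R L : ℕ} (u : Slot R → ℤ) (k : Fin L) (i : Slot R) :
    sourceVector u k i = phase L u i ^ ((k : ℕ) + 1) * amp R := by
  simp [sourceVector, generator, Matrix.diagonal_pow, Matrix.mulVec_diagonal, initialVector,
    phase, amp]

theorem codeword_apply {R L : ℕ} (u : Slot R → ℤ) (M : Matrix (Fin R) (Fin R) ℂ) (k : Fin L)
    (i : Slot R) (j : Fin R) :
    codeword u M k i j = stacked M i j * (phase L u i ^ ((k : ℕ) + 1) * amp R) := by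
  simp [codeword, relayMatrix, Matrix.mulVec_diagonal, sourceVector_apply]

theorem norm_entry {R : ℕ} {M : Matrix (Fin R) (Fin R) ℂ} (hM : IsGBH M) (i j : Fin R) :
    ‖M i j‖ = 1 := by
  have h := hM.star_mul_self i j
  have h2 : ‖M i j‖ * ‖M i j‖ = 1 := by
    have := congrArg norm h
    simpa using this
  nlinarith [norm_nonneg (M i j)]

theorem norm_stacked {R : ℕ} {M : Matrix (Fin R) (Fin R) ℂ} (hM : IsGBH M) (i : Slot R)
    (j : Fin R) : ‖stacked M i j‖ = 1 := by
  rcases i with i | i <;> simp [stacked, norm_entry hM]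

theorem norm_codeword_le {R L : ℕ} (hR : 1 ≤ R) {M : Matrix (Fin R) (Fin R) ℂ} (hM : IsGBH M)
    (u : Slot R → ℤ) (k : Fin L) (i : Slot R) (j : Fin R) : ‖codeword u M k i j‖ ≤ 1 := by
  rw [codeword_apply, norm_mul, norm_mul, norm_pow, norm_phase, norm_stacked hM]
  simpa using norm_amp_le hR

theorem codeword_mulVec {R L : ℕ} (u : Slot R → ℤ) (M : Matrix (Fin R) (Fin R) ℂ) (k : Fin L)
    (a : Fin R → ℂ) (i : Slot R) :
    (codeword u M k *ᵥ a) i = phase L u i ^ ((k : ℕ) + 1) * amp R * (stacked M *ᵥ a) i := by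
  simp only [Matrix.mulVec, dotProduct, codeword_apply, Finset.mul_sum]
  exact Finset.sum_congr rfl fun j _ => by ring

theorem codeword_eq_mul {R L : ℕ} (u : Slot R → ℤ) (M : Matrix (Fin R) (Fin R) ℂ) (k : Fin L) :
    codeword u M k = Matrix.diagonal (fun i => phase L u i ^ ((k : ℕ) + 1)) *
      (amp R • stacked M) := by
  ext i j
  simp [codeword_apply, Matrix.diagonal_mul]
  ring

theorem stacked_mulVec_inl {R : ℕ} (M : Matrix (Fin R) (Fin R) ℂ) (a : Fin R → ℂ) (i : Fin R) :
    (stacked M *ᵥ a) (Sum.inl i) = (M *ᵥ a) i := rfl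

theorem stacked_mulVec_inr {R : ℕ} (M : Matrix (Fin R) (Fin R) ℂ) (a : Fin R → ℂ) (i : Fin R) :
    (stacked M *ᵥ a) (Sum.inr i) = (M *ᵥ a) i := rfl

theorem IsGBH.eq_zero_of_mulVec {R : ℕ} (hR : 1 ≤ R) {M : Matrix (Fin R) (Fin R) ℂ}
    (hM : IsGBH M) {a : Fin R → ℂ} (h : ∀ i, (M *ᵥ a) i = 0) : a = 0 := by
  have h0 : M *ᵥ a = 0 := funext h
  have h1 : Mᴴ *ᵥ (M *ᵥ a) = (R : ℂ) • a := by
    rw [Matrix.mulVec_mulVec, hM.conjTranspose_mul, Matrix.smul_mulVec, Matrix.one_mulVec]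
  rw [h0, Matrix.mulVec_zero] at h1
  have hR' : (R : ℂ) ≠ 0 := by exact_mod_cast (by omega : R ≠ 0)
  exact (smul_eq_zero.mp h1.symm).resolve_left hR'

theorem two_by_two_eq_zero {a b c d x y : ℂ} (hdet : a * d ≠ b * c)
    (h1 : a * x + b * y = 0) (h2 : c * x + d * y = 0) : x = 0 ∧ y = 0 := by
  have hd : a * d - b * c ≠ 0 := sub_ne_zero.mpr hdet
  constructor
  · exact (mul_eq_zero.mp (by linear_combination d * h1 - b * h2 :
      (a * d - b * c) * x = 0)).resolve_left hd
  · exact (mul_eq_zero.mp (by linear_combination a * h2 - c * h1 :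
      (a * d - b * c) * y = 0)).resolve_left hd

theorem det_fromCols_ne_zero {R L : ℕ} (hR : 1 ≤ R) (hL : 2 ≤ L) (u : Slot R → ℤ)
    {M : Matrix (Fin R) (Fin R) ℂ} (hM : IsGBH M)
    (hu : ∀ i : Fin R, Int.gcd (u (Sum.inl i) - u (Sum.inr i)) (L : ℤ) = 1)
    {n m : Fin L} (hnm : n ≠ m) :
    (Matrix.fromCols (codeword u M n) (codeword u M m)).det ≠ 0 := by
  intro hdet
  obtain ⟨x, hx0, hx⟩ := Matrix.exists_mulVec_eq_zero_iff.mpr hdet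
  apply hx0
  rw [Matrix.fromCols_mulVec] at hx
  have key : ∀ i : Fin R, (M *ᵥ (x ∘ Sum.inl)) i = 0 ∧ (M *ᵥ (x ∘ Sum.inr)) i = 0 := by
    intro i
    have h1 := congrFun hx (Sum.inl i)
    have h2 := congrFun hx (Sum.inr i)
    simp only [Pi.add_apply, codeword_mulVec, stacked_mulVec_inl, stacked_mulVec_inr,
      Pi.zero_apply] at h1 h2
    have hne : phase L u (Sum.inl i) ^ ((n : ℕ) + 1) * phase L u (Sum.inr i) ^ ((m : ℕ) + 1) ≠
        phase L u (Sum.inl i) ^ ((m : ℕ) + 1) * phase L u (Sum.inr i) ^ ((n : ℕ) + 1) := by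
      rw [ne_eq, phase_mul_pow_eq_iff (by omega)]
      intro hdvd
      have hc : IsCoprime (L : ℤ) (u (Sum.inl i) - u (Sum.inr i)) :=
        (Int.isCoprime_iff_gcd_eq_one.mpr (hu i)).symm
      -- Coprimality leaves `L ∣ n - m`, and `|n - m| < L` forces equality.
      have h3 := hc.dvd_of_dvd_mul_left hdvd
      have h4 : (((n : ℕ) + 1 : ℕ) : ℤ) - (((m : ℕ) + 1 : ℕ) : ℤ) = 0 := by
        apply Int.eq_zero_of_abs_lt_dvd h3
        have := n.2
        have := m.2
        rw [abs_lt]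
        constructor <;> push_cast <;> omega
      apply hnm
      ext
      omega
    have ha := amp_ne_zero hR
    have := two_by_two_eq_zero (x := amp R * (M *ᵥ (x ∘ Sum.inl)) i)
      (y := amp R * (M *ᵥ (x ∘ Sum.inr)) i) hne
      (by linear_combination h1) (by linear_combination h2)
    exact ⟨(mul_eq_zero.mp this.1).resolve_left ha, (mul_eq_zero.mp this.2).resolve_left ha⟩
  have hl := hM.eq_zero_of_mulVec hR fun i => (key i).1
  have hr := hM.eq_zero_of_mulVec hR fun i => (key i).2
  funext s
  rcases s with s | s
  · exact congrFun hl s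
  · exact congrFun hr s

/-- By orthogonality of rows, `M` maps the conjugate of its row `i` to a multiple of the basis
vector at `i`. Only slots `i` and `R + i` then survive in both products, and a common phase `z` has
to fit just these two. -/
theorem exists_codeword_mulVec_eq {R L : ℕ} (hL : 2 ≤ L) (u : Slot R → ℤ)
    {M : Matrix (Fin R) (Fin R) ℂ} (hM : IsGBH M) {i : Fin R}
    (hu : Int.gcd (u (Sum.inl i) - u (Sum.inr i)) (L : ℤ) ≠ 1) :
    ∃ n m : Fin L, n ≠ m ∧ ∃ z : ℂ, ‖z‖ = 1 ∧
      codeword u M n *ᵥ (fun j => star (M i j)) = z • codeword u M m *ᵥ (fun j => star (M i j)) := by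
  set d := Int.gcd (u (Sum.inl i) - u (Sum.inr i)) (L : ℤ) with hd
  have hdL : (d : ℤ) ∣ L := Int.gcd_dvd_right _ _
  have hdu : (d : ℤ) ∣ u (Sum.inl i) - u (Sum.inr i) := Int.gcd_dvd_left _ _
  have hdL' : d ∣ L := by exact_mod_cast hdL
  obtain ⟨e, he⟩ := hdL'
  have hd0 : d ≠ 0 := by rintro h; rw [h] at he; omega
  have he0 : e ≠ 0 := by rintro rfl; omega
  have hlt : e < L := by
    have : 2 ≤ d := by omega
    nlinarith [Nat.pos_of_ne_zero he0]
  -- With `e = L / d`, the indices `e` and `0` stand for exponents `e + 1` and `1`. Their difference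
  -- `e` makes `(u_i - u_{R+i}) e` a multiple of `L`.
  refine ⟨⟨e, hlt⟩, ⟨0, by omega⟩, by simpa using he0, phase L u (Sum.inl i) ^ e,
    by simp [norm_phase], ?_⟩
  have hMa : M *ᵥ (fun j => star (M i j)) = Pi.single i (R : ℂ) := by
    ext l
    have := congrFun (congrFun hM.mul_conjTranspose l) i
    simp only [Matrix.mul_apply, Matrix.conjTranspose_apply, Matrix.smul_apply,
      Matrix.one_apply] at this
    simp only [Matrix.mulVec, dotProduct, this, Pi.single_apply]
    simp
  have hph : phase L u (Sum.inl i) ^ (e + 1) * phase L u (Sum.inr i) ^ (0 + 1) =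
      phase L u (Sum.inl i) ^ (0 + 1) * phase L u (Sum.inr i) ^ (e + 1) := by
    rw [phase_mul_pow_eq_iff (by omega)]
    obtain ⟨c, hc⟩ := hdu
    refine ⟨c, ?_⟩
    rw [hc, he]
    push_cast
    ring
  have hph' : phase L u (Sum.inr i) ^ e = phase L u (Sum.inl i) ^ e := by
    have h1 := phase_ne_zero L u (Sum.inl i)
    have h2 := phase_ne_zero L u (Sum.inr i)
    refine mul_left_cancel₀ (mul_ne_zero h1 h2) ?_
    linear_combination -hph
  funext s
  rw [Pi.smul_apply, codeword_mulVec, codeword_mulVec]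
  rcases s with s | s
  · simp only [stacked_mulVec_inl, hMa, smul_eq_mul]
    by_cases hs : s = i
    · subst hs; ring
    · simp [hs]
  · simp only [stacked_mulVec_inr, hMa, smul_eq_mul]
    by_cases hs : s = i
    · subst hs; rw [pow_succ, hph']; ring
    · simp [hs]

theorem meetsDeterminantCriterion_iff {R L : ℕ} (hR : 1 ≤ R) (hL : 2 ≤ L) (u : Slot R → ℤ)
    {M : Matrix (Fin R) (Fin R) ℂ} (hM : IsGBH M) :
    MeetsDeterminantCriterion (fun k : Fin L => codeword u M k) ↔
      ∀ i : Fin R, Int.gcd (u (Sum.inl i) - u (Sum.inr i)) (L : ℤ) = 1 := by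
  constructor
  · intro h i
    by_contra hi
    obtain ⟨n, m, hnm, z, -, hz⟩ := exists_codeword_mulVec_eq hL u hM hi
    refine h n m hnm (Matrix.exists_mulVec_eq_zero_iff.mp
      ⟨Sum.elim (fun j => star (M i j)) (-z • fun j => star (M i j)), ?_, ?_⟩)
    · intro h0
      have h1 := congrFun h0 (Sum.inl i)
      simp only [Sum.elim_inl, Pi.zero_apply, star_eq_zero] at h1
      have := norm_entry hM i i
      rw [h1] at this
      simp at this
    · rw [← Matrix.mulVec_mulVec, Matrix.fromCols_mulVec]
      have : codeword u M n *ᵥ (fun j => star (M i j)) +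
          codeword u M m *ᵥ (-z • fun j => star (M i j)) = 0 := by
        rw [Matrix.mulVec_smul, hz, neg_smul, add_neg_cancel]
      simp only [Sum.elim_comp_inl, Sum.elim_comp_inr, this, Matrix.mulVec_zero]
  · intro hu n m hnm
    -- The block matrix is square of size `2R`, so the Gram determinant factors.
    rw [Matrix.det_mul, Matrix.det_conjTranspose]
    have := det_fromCols_ne_zero hR hL u hM hu hnm
    exact mul_ne_zero (star_ne_zero.mpr this) this

/-! ### The equivalent end-to-end channel. -/

/-- The gain `√ρ` of the end-to-end channel. -/
def gain (R : ℕ) (P₁ P₂ : ℝ) : ℝ := Real.sqrt (P₂ / (1 + P₁)) * Real.sqrt (P₁ * (2 * R))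

/-- The relay noise as seen at the destination. -/
def relayNoise {R : ℕ} (M : Matrix (Fin R) (Fin R) ℂ) (P₁ P₂ : ℝ) (g : Fin R → ℂ)
    (n : Fin R → Slot R → ℂ) : Slot R → ℂ :=
  fun i => ∑ j, g j * (Real.sqrt (P₂ / (1 + P₁)) * (stacked M i j * n j i))

theorem received_eq {R L : ℕ} (u : Slot R → ℤ) (M : Matrix (Fin R) (Fin R) ℂ) (P₁ P₂ : ℝ)
    (k : Fin L) (f g : Fin R → ℂ) (n : Fin R → Slot R → ℂ) (w : Slot R → ℂ) :
    received u M P₁ P₂ k (f, g, n, w) =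
      (gain R P₁ P₂ : ℂ) • codeword u M k *ᵥ (f * g) + relayNoise M P₁ P₂ g n + w := by
  funext i
  have hA : ∀ (j : Fin R) (v : Slot R → ℂ), (relayMatrix M j *ᵥ v) i = stacked M i j * v i :=
    fun j v => by rw [relayMatrix, Matrix.mulVec_diagonal]
  simp only [received, Pi.add_apply, Finset.sum_apply, Pi.smul_apply, smul_eq_mul,
    relayTransmitted, relayReceived, hA, sourceVector_apply, relayNoise, gain]
  simp only [Matrix.mulVec, dotProduct, codeword_apply, Finset.mul_sum,
    ← Finset.sum_add_distrib, Pi.mul_apply]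
  congr 1
  refine Finset.sum_congr rfl fun j _ => ?_
  push_cast
  ring

/-! ### The maximum likelihood decision -/

section

open scoped ComplexOrder

/-- The conditional variance of the noise at the destination. -/
def noiseLevel {R : ℕ} (P₁ P₂ : ℝ) (g : Fin R → ℂ) : ℝ := 1 + P₂ / (1 + P₁) * ∑ j, ‖g j‖ ^ 2

theorem one_le_noiseLevel {R : ℕ} {P₁ P₂ : ℝ} (h₁ : 0 ≤ P₁) (h₂ : 0 ≤ P₂) (g : Fin R → ℂ) :
    1 ≤ noiseLevel P₁ P₂ g := by
  have : 0 ≤ P₂ / (1 + P₁) * ∑ j, ‖g j‖ ^ 2 := by positivity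
  rw [noiseLevel]; linarith

theorem gain_nonneg (R : ℕ) (P₁ P₂ : ℝ) : 0 ≤ gain R P₁ P₂ := by
  rw [gain]; positivity

theorem gain_sq (R : ℕ) {P₁ P₂ : ℝ} (h₁ : 0 ≤ P₁) (h₂ : 0 ≤ P₂) :
    gain R P₁ P₂ ^ 2 = P₁ * P₂ * (2 * R) / (1 + P₁) := by
  rw [gain, mul_pow, Real.sq_sqrt (by positivity), Real.sq_sqrt (by positivity)]
  ring

theorem covariance_eq {R : ℕ} {P₁ P₂ : ℝ} (h₁ : 0 ≤ P₁) (h₂ : 0 ≤ P₂)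
    (S : Matrix (Slot R) (Fin R) ℂ) (g : Fin R → ℂ) :
    covariance P₁ P₂ S g = ((gain R P₁ P₂ ^ 2 : ℝ) : ℂ) •
      (S * Matrix.diagonal (fun j => ((‖g j‖ ^ 2 : ℝ) : ℂ)) * Sᴴ) +
      (noiseLevel P₁ P₂ g : ℂ) • (1 : Matrix (Slot R) (Slot R) ℂ) := by
  rw [covariance, gain_sq R h₁ h₂, noiseLevel]

theorem covariance_mulVec {R : ℕ} {P₁ P₂ : ℝ} (h₁ : 0 ≤ P₁) (h₂ : 0 ≤ P₂)
    (S : Matrix (Slot R) (Fin R) ℂ) (g : Fin R → ℂ) (q : Slot R → ℂ) :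
    covariance P₁ P₂ S g *ᵥ q =
      S *ᵥ (fun j => ((gain R P₁ P₂ ^ 2 * ‖g j‖ ^ 2 : ℝ) : ℂ) * (Sᴴ *ᵥ q) j) +
      (noiseLevel P₁ P₂ g : ℂ) • q := by
  rw [covariance_eq h₁ h₂, Matrix.add_mulVec, Matrix.smul_mulVec, Matrix.smul_mulVec,
    Matrix.one_mulVec, ← Matrix.mulVec_mulVec, ← Matrix.mulVec_mulVec, ← Matrix.mulVec_smul]
  congr 2
  funext j
  rw [Pi.smul_apply, Matrix.mulVec_diagonal, smul_eq_mul]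
  push_cast
  ring

theorem star_dotProduct_mulVec {m n : Type*} [Fintype m] [Fintype n] (S : Matrix m n ℂ)
    (q : m → ℂ) (a : n → ℂ) : star q ⬝ᵥ (S *ᵥ a) = star (Sᴴ *ᵥ q) ⬝ᵥ a := by
  rw [Matrix.dotProduct_mulVec, Matrix.star_mulVec, Matrix.conjTranspose_conjTranspose]

theorem covariance_quadForm {R : ℕ} {P₁ P₂ : ℝ} (h₁ : 0 ≤ P₁) (h₂ : 0 ≤ P₂)
    (S : Matrix (Slot R) (Fin R) ℂ) (g : Fin R → ℂ) (q : Slot R → ℂ) :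
    star q ⬝ᵥ (covariance P₁ P₂ S g *ᵥ q) =
      ((∑ j, gain R P₁ P₂ ^ 2 * ‖g j‖ ^ 2 * ‖(Sᴴ *ᵥ q) j‖ ^ 2 +
        ∑ i, noiseLevel P₁ P₂ g * ‖q i‖ ^ 2 : ℝ) : ℂ) := by
  rw [covariance_mulVec h₁ h₂, dotProduct_add, star_dotProduct_mulVec]
  simp only [dotProduct, Pi.star_apply, Pi.smul_apply, smul_eq_mul]
  push_cast
  congr 1
  · refine Finset.sum_congr rfl fun j _ => ?_
    rw [← Complex.conj_mul' ((Sᴴ *ᵥ q) j)]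
    simp only [starRingEnd_apply]
    ring
  · refine Finset.sum_congr rfl fun j _ => ?_
    rw [← Complex.conj_mul']
    simp only [starRingEnd_apply]
    ring

theorem covariance_posDef {R : ℕ} {P₁ P₂ : ℝ} (h₁ : 0 ≤ P₁) (h₂ : 0 ≤ P₂)
    (S : Matrix (Slot R) (Fin R) ℂ) (g : Fin R → ℂ) : (covariance P₁ P₂ S g).PosDef := by
  have hγ := one_le_noiseLevel h₁ h₂ g
  refine Matrix.PosDef.of_dotProduct_mulVec_pos ?_ ?_
  · rw [covariance_eq h₁ h₂, Matrix.IsHermitian, Matrix.conjTranspose_add,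
      Matrix.conjTranspose_smul, Matrix.conjTranspose_smul, Matrix.conjTranspose_mul,
      Matrix.conjTranspose_mul, Matrix.conjTranspose_conjTranspose, Matrix.diagonal_conjTranspose,
      Matrix.conjTranspose_one, ← Matrix.mul_assoc]
    have : (star fun j => ((‖g j‖ ^ 2 : ℝ) : ℂ)) = fun j => ((‖g j‖ ^ 2 : ℝ) : ℂ) := by
      funext j
      simp [Pi.star_apply]
    rw [this]
    simp
  · intro q hq
    rw [covariance_quadForm h₁ h₂]
    norm_cast
    obtain ⟨i, hi⟩ := Function.ne_iff.mp hq
    have hi' : 0 < ‖q i‖ := norm_pos_iff.mpr hi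
    have h3 : 0 < ∑ i, noiseLevel P₁ P₂ g * ‖q i‖ ^ 2 :=
      Finset.sum_pos' (fun i _ => by positivity) ⟨i, Finset.mem_univ _, by positivity⟩
    have h4 : 0 ≤ ∑ j, gain R P₁ P₂ ^ 2 * ‖g j‖ ^ 2 * ‖(Sᴴ *ᵥ q) j‖ ^ 2 :=
      Finset.sum_nonneg fun j _ => by positivity
    exact add_pos_of_nonneg_of_pos h4 h3

/-- Codewords differ from a fixed matrix by a unitary diagonal factor on the left, which conjugates
the covariance. The likelihood ratio thus depends on the quadratic forms alone. -/
theorem covariance_codeword_det {R L : ℕ} (u : Slot R → ℤ) (M : Matrix (Fin R) (Fin R) ℂ)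
    {P₁ P₂ : ℝ} (h₁ : 0 ≤ P₁) (h₂ : 0 ≤ P₂) (g : Fin R → ℂ) (k : Fin L) :
    (covariance P₁ P₂ (codeword u M k) g).det =
      (covariance P₁ P₂ (amp R • stacked M) g).det := by
  set E : Matrix (Slot R) (Slot R) ℂ :=
    Matrix.diagonal (fun i => phase L u i ^ ((k : ℕ) + 1)) with hE
  have hEE : E * Eᴴ = 1 := by
    rw [hE, Matrix.diagonal_conjTranspose, Matrix.diagonal_mul_diagonal, ← Matrix.diagonal_one]
    congr 1
    funext i
    have : ‖phase L u i ^ ((k : ℕ) + 1)‖ = 1 := by simp [norm_phase]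
    rw [Pi.star_apply, Complex.star_def, Complex.mul_conj', this]
    simp
  have h : covariance P₁ P₂ (codeword u M k) g =
      E * covariance P₁ P₂ (amp R • stacked M) g * Eᴴ := by
    rw [covariance_eq h₁ h₂, covariance_eq h₁ h₂, codeword_eq_mul, ← hE, Matrix.mul_add,
      Matrix.add_mul, Matrix.conjTranspose_mul]
    simp only [Matrix.mul_smul, Matrix.smul_mul, Matrix.mul_one, hEE, Matrix.mul_assoc]
  rw [h, Matrix.det_mul, Matrix.det_mul, mul_right_comm, ← Matrix.det_mul, hEE, Matrix.det_one,
    one_mul]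

theorem quadForm_le_of_likelihood_le {R L : ℕ} (u : Slot R → ℤ) (M : Matrix (Fin R) (Fin R) ℂ)
    {P₁ P₂ : ℝ} (h₁ : 0 ≤ P₁) (h₂ : 0 ≤ P₂) (g : Fin R → ℂ) (y : Slot R → ℂ) {k m : Fin L}
    (h : likelihood P₁ P₂ (codeword u M k) g y ≤ likelihood P₁ P₂ (codeword u M m) g y) :
    (star y ⬝ᵥ ((covariance P₁ P₂ (codeword u M m) g)⁻¹ *ᵥ y)).re ≤
      (star y ⬝ᵥ ((covariance P₁ P₂ (codeword u M k) g)⁻¹ *ᵥ y)).re := by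
  have hdet := (covariance_posDef h₁ h₂ (amp R • stacked M) g).det_pos
  have hdet' : 0 < (covariance P₁ P₂ (amp R • stacked M) g).det.re := (Complex.pos_iff.mp hdet).1
  simp only [likelihood, covariance_codeword_det u M h₁ h₂] at h
  have hc : 0 < (Real.pi ^ (2 * R) * (covariance P₁ P₂ (amp R • stacked M) g).det.re)⁻¹ := by
    positivity
  have := Real.exp_le_exp.mp (le_of_mul_le_mul_left h hc)
  linarith

theorem re_star_mul_le (a b : ℂ) : (star a * b).re ≤ (‖a‖ ^ 2 + ‖b‖ ^ 2) / 2 := by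
  have h1 : (star a * b).re ≤ ‖a‖ * ‖b‖ := by
    have := Complex.re_le_norm (star a * b)
    rwa [norm_mul, norm_star] at this
  nlinarith [sq_nonneg (‖a‖ - ‖b‖)]

theorem covariance_mulVec_inv {R : ℕ} {P₁ P₂ : ℝ} (h₁ : 0 ≤ P₁) (h₂ : 0 ≤ P₂)
    (S : Matrix (Slot R) (Fin R) ℂ) (g : Fin R → ℂ) (y : Slot R → ℂ) :
    covariance P₁ P₂ S g *ᵥ ((covariance P₁ P₂ S g)⁻¹ *ᵥ y) = y := by
  have hdet := (covariance_posDef h₁ h₂ S g).det_pos.ne'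
  rw [Matrix.mulVec_mulVec, Matrix.mul_nonsing_inv _ (isUnit_iff_ne_zero.mpr hdet),
    Matrix.one_mulVec]

theorem re_star_dotProduct_comm {m : Type*} [Fintype m] (a b : m → ℂ) :
    (star a ⬝ᵥ b).re = (star b ⬝ᵥ a).re := by
  simp only [dotProduct, Complex.re_sum]
  refine Finset.sum_congr rfl fun i _ => ?_
  simp [Complex.mul_re]
  ring

/-- The quadratic form in the exponent of the likelihood of `S` is a sum of squares in the
whitened observation. -/
theorem quadForm_inv_eq {R : ℕ} {P₁ P₂ : ℝ} (h₁ : 0 ≤ P₁) (h₂ : 0 ≤ P₂)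
    (S : Matrix (Slot R) (Fin R) ℂ) (g : Fin R → ℂ) (y : Slot R → ℂ) :
    (star y ⬝ᵥ ((covariance P₁ P₂ S g)⁻¹ *ᵥ y)).re =
      ∑ j, gain R P₁ P₂ ^ 2 * ‖g j‖ ^ 2 * ‖(Sᴴ *ᵥ ((covariance P₁ P₂ S g)⁻¹ *ᵥ y)) j‖ ^ 2 +
        ∑ i, noiseLevel P₁ P₂ g * ‖((covariance P₁ P₂ S g)⁻¹ *ᵥ y) i‖ ^ 2 := by
  have h := covariance_quadForm h₁ h₂ S g ((covariance P₁ P₂ S g)⁻¹ *ᵥ y)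
  rw [covariance_mulVec_inv h₁ h₂] at h
  rw [re_star_dotProduct_comm, h, Complex.ofReal_re]

/-- With `q = Σ⁻¹ y`, the form `Q` is the real pairing of `q` with `y`. Moving `S` to the other side
and using `2 Re(āb) ≤ |a|² + |b|²` termwise gives at most half of the sum of squares in
`quadForm_inv_eq`, which is `Q` itself, plus half of the right-hand side. The term `Q / 2` is
absorbed. -/
theorem quadForm_inv_le {R : ℕ} {P₁ P₂ : ℝ} (h₁ : 0 ≤ P₁) (h₂ : 0 ≤ P₂)
    (S : Matrix (Slot R) (Fin R) ℂ) (f g : Fin R → ℂ) (v : Slot R → ℂ) {y : Slot R → ℂ}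
    (hy : y = (gain R P₁ P₂ : ℂ) • S *ᵥ (f * g) + v) :
    (star y ⬝ᵥ ((covariance P₁ P₂ S g)⁻¹ *ᵥ y)).re ≤ ∑ j, ‖f j‖ ^ 2 + ∑ i, ‖v i‖ ^ 2 := by
  have hQ := quadForm_inv_eq h₁ h₂ S g y
  set q := (covariance P₁ P₂ S g)⁻¹ *ᵥ y
  set Q := (star y ⬝ᵥ q).re
  have hγ := one_le_noiseLevel h₁ h₂ g
  have h3 : Q ≤ ∑ j, (gain R P₁ P₂ ^ 2 * ‖g j‖ ^ 2 * ‖(Sᴴ *ᵥ q) j‖ ^ 2 + ‖f j‖ ^ 2) / 2 +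
      ∑ i, (noiseLevel P₁ P₂ g * ‖q i‖ ^ 2 + ‖v i‖ ^ 2) / 2 := by
    have h4 : Q = (star q ⬝ᵥ y).re := re_star_dotProduct_comm _ _
    rw [h4, hy, dotProduct_add, Complex.add_re, dotProduct_smul, star_dotProduct_mulVec,
      dotProduct, dotProduct, Finset.smul_sum, Complex.re_sum, Complex.re_sum]
    refine add_le_add (Finset.sum_le_sum fun j _ => ?_) (Finset.sum_le_sum fun i _ => ?_)
    · have h5 := re_star_mul_le ((gain R P₁ P₂ : ℂ) * star (g j) * (Sᴴ *ᵥ q) j) (f j)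
      rw [norm_mul, norm_mul, norm_star, Complex.norm_real, Real.norm_of_nonneg (gain_nonneg _ _ _),
        mul_pow, mul_pow] at h5
      refine le_trans (le_of_eq ?_) h5
      congr 1
      simp only [star_mul', Complex.star_def, Complex.conj_ofReal, Complex.conj_conj,
        Pi.mul_apply, Pi.star_apply, smul_eq_mul]
      ring
    · refine (re_star_mul_le (q i) (v i)).trans ?_
      have : ‖q i‖ ^ 2 ≤ noiseLevel P₁ P₂ g * ‖q i‖ ^ 2 :=
        le_mul_of_one_le_left (by positivity) hγ
      linarith
  simp only [add_div, Finset.sum_add_distrib, ← Finset.sum_div] at h3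
  linarith

/-- If a maximum likelihood decoder prefers `m` to the true message `k`, then all the products
`f_j g_j` are small compared with the noise. -/
theorem exists_gain_mul_le {R L : ℕ} (u : Slot R → ℤ) (M : Matrix (Fin R) (Fin R) ℂ)
    (hdet : ∀ k m : Fin L, k ≠ m →
      (Matrix.fromCols (codeword u M k) (codeword u M m)).det ≠ 0) :
    ∃ C : ℝ, 0 ≤ C ∧ ∀ (P₁ P₂ : ℝ), 0 ≤ P₁ → 0 ≤ P₂ → ∀ (f g : Fin R → ℂ) (v y : Slot R → ℂ)
      (k m : Fin L), k ≠ m → y = (gain R P₁ P₂ : ℂ) • codeword u M k *ᵥ (f * g) + v →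
      likelihood P₁ P₂ (codeword u M k) g y ≤ likelihood P₁ P₂ (codeword u M m) g y →
      ∀ j, gain R P₁ P₂ * (‖f j‖ * ‖g j‖) ≤ C * ∑ i, (noiseLevel P₁ P₂ g +
        (∑ j, ‖f j‖ ^ 2 + ∑ i, ‖v i‖ ^ 2) + ‖v i‖) := by
  let N : Fin L → Fin L → Matrix (Slot R) (Slot R) ℂ :=
    fun k m => Matrix.fromCols (codeword u M k) (codeword u M m)
  -- Summing over all pairs of messages makes the constant independent of the pair, the powers and
  -- the fading.
  refine ⟨∑ k, ∑ m, ∑ a, ∑ b, ‖(N k m)⁻¹ a b‖, by positivity, ?_⟩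
  intro P₁ P₂ h₁ h₂ f g v y k m hkm hy hlik j
  have hC : ∀ a b, ‖(N k m)⁻¹ a b‖ ≤ ∑ k, ∑ m, ∑ a, ∑ b, ‖(N k m)⁻¹ a b‖ := by
    intro a b
    calc ‖(N k m)⁻¹ a b‖ ≤ ∑ b, ‖(N k m)⁻¹ a b‖ :=
          Finset.single_le_sum (f := fun b => ‖(N k m)⁻¹ a b‖)
            (fun _ _ => norm_nonneg _) (Finset.mem_univ b)
      _ ≤ ∑ a, ∑ b, ‖(N k m)⁻¹ a b‖ :=
          Finset.single_le_sum (f := fun a => ∑ b, ‖(N k m)⁻¹ a b‖)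
            (fun _ _ => by positivity) (Finset.mem_univ a)
      _ ≤ ∑ m, ∑ a, ∑ b, ‖(N k m)⁻¹ a b‖ :=
          Finset.single_le_sum (f := fun m => ∑ a, ∑ b, ‖(N k m)⁻¹ a b‖)
            (fun _ _ => by positivity) (Finset.mem_univ m)
      _ ≤ _ := Finset.single_le_sum (f := fun k => ∑ m, ∑ a, ∑ b, ‖(N k m)⁻¹ a b‖)
            (fun _ _ => by positivity) (Finset.mem_univ k)
  set C := ∑ k, ∑ m, ∑ a, ∑ b, ‖(N k m)⁻¹ a b‖
  have hγ := one_le_noiseLevel h₁ h₂ g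
  have hQk := quadForm_inv_le h₁ h₂ (codeword u M k) f g v hy
  have hQm := quadForm_le_of_likelihood_le u M h₁ h₂ g y hlik
  have hQ := quadForm_inv_eq h₁ h₂ (codeword u M m) g y
  have hyq := covariance_mulVec_inv h₁ h₂ (codeword u M m) g y
  set q := (covariance P₁ P₂ (codeword u M m) g)⁻¹ *ᵥ y
  set Q := (star y ⬝ᵥ q).re
  set γ := noiseLevel P₁ P₂ g
  set B := ∑ j, ‖f j‖ ^ 2 + ∑ i, ‖v i‖ ^ 2
  have hQB : Q ≤ B := hQm.trans hQk
  have hqi : ∀ i, γ * ‖q i‖ ≤ γ + B := by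
    intro i
    have h3 : γ * ‖q i‖ ^ 2 ≤ ∑ i, γ * ‖q i‖ ^ 2 :=
      Finset.single_le_sum (f := fun i => γ * ‖q i‖ ^ 2)
        (fun _ _ => by positivity) (Finset.mem_univ i)
    have h4 : 0 ≤ ∑ j, gain R P₁ P₂ ^ 2 * ‖g j‖ ^ 2 *
        ‖((codeword u M m)ᴴ *ᵥ q) j‖ ^ 2 := by positivity
    have h5 : γ * ‖q i‖ ^ 2 ≤ B := by linarith
    nlinarith [sq_nonneg (‖q i‖ - 1), norm_nonneg (q i)]
  rw [covariance_mulVec h₁ h₂] at hyq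
  set b : Fin R → ℂ := fun j => ((gain R P₁ P₂ ^ 2 * ‖g j‖ ^ 2 : ℝ) : ℂ) *
    ((codeword u M m)ᴴ *ᵥ q) j
  -- Equate the two expressions for `y`: the channel output under `k`, and `Σ_m q = S_m b + γ q`.
  have hN : N k m *ᵥ Sum.elim ((gain R P₁ P₂ : ℂ) • (f * g)) (-b) = (γ : ℂ) • q - v := by
    rw [Matrix.fromCols_mulVec, Sum.elim_comp_inl, Sum.elim_comp_inr, Matrix.mulVec_smul,
      Matrix.mulVec_neg]
    have := hyq.trans hy
    rw [← sub_eq_zero] at this ⊢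
    rw [← neg_eq_zero, ← this]
    abel
  have hinv : (N k m)⁻¹ *ᵥ ((γ : ℂ) • q - v) =
      Sum.elim ((gain R P₁ P₂ : ℂ) • (f * g)) (-b) := by
    rw [← hN, Matrix.mulVec_mulVec,
      Matrix.nonsing_inv_mul _ (isUnit_iff_ne_zero.mpr (hdet k m hkm)), Matrix.one_mulVec]
  have hj := congrFun hinv (Sum.inl j)
  rw [Sum.elim_inl, Pi.smul_apply, Pi.mul_apply, smul_eq_mul] at hj
  calc gain R P₁ P₂ * (‖f j‖ * ‖g j‖) = ‖(gain R P₁ P₂ : ℂ) * (f j * g j)‖ := by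
        rw [norm_mul, norm_mul, Complex.norm_real, Real.norm_of_nonneg (gain_nonneg _ _ _)]
    _ = ‖∑ i, (N k m)⁻¹ (Sum.inl j) i * ((γ : ℂ) • q - v) i‖ := by rw [← hj]; rfl
    _ ≤ ∑ i, ‖(N k m)⁻¹ (Sum.inl j) i * ((γ : ℂ) • q - v) i‖ := norm_sum_le _ _
    _ ≤ ∑ i, C * (γ + B + ‖v i‖) := by
        refine Finset.sum_le_sum fun i _ => ?_
        rw [norm_mul]
        refine mul_le_mul (hC _ _) ?_ (norm_nonneg _) ((norm_nonneg _).trans (hC (Sum.inl j) i))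
        rw [Pi.sub_apply, Pi.smul_apply, smul_eq_mul]
        refine (norm_sub_le _ _).trans ?_
        rw [norm_mul, Complex.norm_real, Real.norm_of_nonneg (by linarith)]
        linarith [hqi i]
    _ = _ := by rw [Finset.mul_sum]

end

/-! ### Upper bound for the error probability -/

open MeasureTheory

theorem integrable_norm_rpow_cscg {q : ℝ} (hq : -2 < q) :
    Integrable (fun z : ℂ => ‖z‖ ^ q) cscg := by
  have hint : Integrable (fun z : ℂ => ‖z‖ ^ q * Real.exp (-‖z‖ ^ (2 : ℝ))) := by
    -- The integral of a non-integrable function is `0` by convention, whereas the closed formula is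
    -- positive.
    by_contra hn
    have h := Complex.integral_rpow_mul_exp_neg_rpow one_le_two hq
    rw [integral_undef hn] at h
    have : 0 < Real.Gamma ((q + 2) / 2) := Real.Gamma_pos_of_pos (by linarith)
    have : 0 < 2 * Real.pi / 2 * Real.Gamma ((q + 2) / 2) := by positivity
    linarith
  rw [cscg, integrable_withDensity_iff (by fun_prop)
    (Filter.Eventually.of_forall fun _ => ENNReal.ofReal_lt_top)]
  refine (hint.const_mul Real.pi⁻¹).congr (Filter.Eventually.of_forall fun z => ?_)
  simp only [Real.rpow_two]
  rw [ENNReal.toReal_ofReal (by positivity)]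
  ring

/-- The bound `s < 2` is what integrability at the origin of the plane requires; it is the source of
the diversity exponent. -/
theorem integrable_one_add_pow_mul_rpow_cscg (p : ℕ) {s : ℝ} (hs : s < 2) :
    Integrable (fun z : ℂ => (1 + ‖z‖) ^ p * ‖z‖ ^ (-s)) cscg := by
  have h1 := integrable_norm_rpow_cscg (q := -s) (by linarith)
  have h2 := integrable_norm_rpow_cscg (q := p - s) (by
    have : (0 : ℝ) ≤ p := by positivity
    linarith)
  refine ((h1.add h2).const_mul (2 ^ p)).mono' (by fun_prop)
    (Filter.Eventually.of_forall fun z => ?_)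
  rw [Real.norm_of_nonneg (by positivity), Pi.add_apply]
  rcases le_or_gt ‖z‖ 1 with hz | hz
  · have h3 : (1 + ‖z‖) ^ p ≤ 2 ^ p := pow_le_pow_left₀ (by positivity) (by linarith) p
    have h4 : 0 ≤ ‖z‖ ^ ((p : ℝ) - s) := by positivity
    have h5 : 0 ≤ ‖z‖ ^ (-s) := by positivity
    calc _ ≤ 2 ^ p * ‖z‖ ^ (-s) := by gcongr
      _ ≤ _ := by gcongr; linarith
  · have h3 : (1 + ‖z‖) ^ p ≤ 2 ^ p * ‖z‖ ^ p := by
      rw [← mul_pow]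
      exact pow_le_pow_left₀ (by positivity) (by linarith) p
    have h4 : ‖z‖ ^ ((p : ℝ) - s) = ‖z‖ ^ p * ‖z‖ ^ (-s) := by
      rw [sub_eq_add_neg, Real.rpow_add (by linarith), Real.rpow_natCast]
    have h5 : 0 ≤ ‖z‖ ^ (-s) := by positivity
    calc _ ≤ 2 ^ p * ‖z‖ ^ p * ‖z‖ ^ (-s) := by gcongr
      _ = 2 ^ p * ‖z‖ ^ ((p : ℝ) - s) := by rw [h4]; ring
      _ ≤ _ := by gcongr; linarith

/-! ### An integrable majorant for the error event. -/

theorem norm_le_prod_one_add {ι : Type*} [Fintype ι] (x : ι → ℂ) (i : ι) :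
    ‖x i‖ ≤ ∏ j, (1 + ‖x j‖) := by
  classical
  rw [← Finset.mul_prod_erase _ _ (Finset.mem_univ i)]
  have h : 1 ≤ ∏ j ∈ Finset.univ.erase i, (1 + ‖x j‖) :=
    Finset.one_le_prod fun j _ => by linarith [norm_nonneg (x j)]
  nlinarith [norm_nonneg (x i)]

theorem one_le_prod_one_add {ι : Type*} [Fintype ι] (x : ι → ℂ) :
    1 ≤ ∏ j, (1 + ‖x j‖) :=
  Finset.one_le_prod fun j _ => by linarith [norm_nonneg (x j)]

/-- A product dominating every coordinate of a realization, and every product of coordinates from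
different groups. -/
def spread {R : ℕ} (ω : Realization R) : ℝ :=
  (∏ j, (1 + ‖ω.1 j‖)) * ((∏ j, (1 + ‖ω.2.1 j‖)) *
    ((∏ j, ∏ i, (1 + ‖ω.2.2.1 j i‖)) * ∏ i, (1 + ‖ω.2.2.2 i‖)))

theorem le_spread {R : ℕ} (f g : Fin R → ℂ) (n : Fin R → Slot R → ℂ) (w : Slot R → ℂ) :
    1 ≤ spread (f, g, n, w) ∧ (∀ j, ‖f j‖ ≤ spread (f, g, n, w)) ∧
      (∀ j, ‖g j‖ ≤ spread (f, g, n, w)) ∧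
      (∀ j i, ‖n j i‖ ≤ spread (f, g, n, w)) ∧ ∀ i, ‖w i‖ ≤ spread (f, g, n, w) := by
  have hn1 : 1 ≤ ∏ j, ∏ i, (1 + ‖n j i‖) :=
    Finset.one_le_prod fun j _ => one_le_prod_one_add (n j)
  have hn : ∀ j i, ‖n j i‖ ≤ ∏ j, ∏ i, (1 + ‖n j i‖) := by
    intro j i
    rw [← Fintype.prod_prod_type' (fun j i => 1 + ‖n j i‖)]
    exact norm_le_prod_one_add (fun x : Fin R × Slot R => n x.1 x.2) (j, i)
  have hf1 := one_le_prod_one_add f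
  have hg1 := one_le_prod_one_add g
  have hw1 := one_le_prod_one_add w
  simp only [spread]
  set a := ∏ j, (1 + ‖f j‖)
  set b := ∏ j, (1 + ‖g j‖)
  set c := ∏ j, ∏ i, (1 + ‖n j i‖)
  set d := ∏ i, (1 + ‖w i‖)
  have hcd : 1 ≤ c * d := one_le_mul_of_one_le_of_one_le hn1 hw1
  have hbcd : 1 ≤ b * (c * d) := one_le_mul_of_one_le_of_one_le hg1 hcd
  have e1 : b * (c * d) ≤ a * (b * (c * d)) := le_mul_of_one_le_left (by linarith) hf1
  have e2 : c * d ≤ b * (c * d) := le_mul_of_one_le_left (by linarith) hg1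
  refine ⟨one_le_mul_of_one_le_of_one_le hf1 hbcd, fun j => ?_, fun j => ?_, fun j i => ?_,
    fun i => ?_⟩
  · exact (norm_le_prod_one_add f j).trans (le_mul_of_one_le_right (by linarith) hbcd)
  · exact ((norm_le_prod_one_add g j).trans (le_mul_of_one_le_right (by linarith) hcd)).trans e1
  · exact (((hn j i).trans (le_mul_of_one_le_right (by linarith) hw1)).trans e2).trans e1
  · exact (((norm_le_prod_one_add w i).trans (le_mul_of_one_le_left (by linarith) hn1)).trans
      e2).trans e1

theorem norm_relayNoise_le {R : ℕ} {M : Matrix (Fin R) (Fin R) ℂ} (hM : IsGBH M) {P₁ P₂ β B : ℝ}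
    (hβ : P₂ / (1 + P₁) ≤ β) {g : Fin R → ℂ} {n : Fin R → Slot R → ℂ}
    (hg : ∀ j, ‖g j‖ ≤ B) (hn : ∀ j i, ‖n j i‖ ≤ B) (hB : 0 ≤ B) (i : Slot R) :
    ‖relayNoise M P₁ P₂ g n i‖ ≤ R * Real.sqrt β * B ^ 2 := by
  calc ‖relayNoise M P₁ P₂ g n i‖
      ≤ ∑ j, ‖g j * (Real.sqrt (P₂ / (1 + P₁)) * (stacked M i j * n j i))‖ := norm_sum_le _ _
    _ ≤ ∑ _j : Fin R, Real.sqrt β * B ^ 2 := by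
        refine Finset.sum_le_sum fun j _ => ?_
        rw [norm_mul, norm_mul, norm_mul, norm_stacked hM, one_mul, Complex.norm_real,
          Real.norm_of_nonneg (Real.sqrt_nonneg _)]
        have h1 := Real.sqrt_le_sqrt hβ
        have h2 := hg j
        have h3 := hn j i
        calc _ ≤ B * (Real.sqrt β * B) := by gcongr
          _ = _ := by ring
    _ = _ := by simp; ring

/-- The exponent `4` arises because the relay noise contains products `g_j n_j`, quadratic in
`spread`, and is squared once more. -/
theorem noise_sum_le {R : ℕ} {M : Matrix (Fin R) (Fin R) ℂ} (hM : IsGBH M) {β : ℝ} (hβ0 : 0 ≤ β)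
    {P₁ P₂ : ℝ} (hβ : P₂ / (1 + P₁) ≤ β)
    (f g : Fin R → ℂ) (n : Fin R → Slot R → ℂ) (w : Slot R → ℂ) :
    ∑ i, (noiseLevel P₁ P₂ g + (∑ j, ‖f j‖ ^ 2 + ∑ i, ‖(relayNoise M P₁ P₂ g n + w) i‖ ^ 2) +
        ‖(relayNoise M P₁ P₂ g n + w) i‖) ≤
      (∑ _i : Slot R, ((1 + β * R) + (R + ∑ _i : Slot R, (R * Real.sqrt β + 1) ^ 2) +
        (R * Real.sqrt β + 1))) * spread (f, g, n, w) ^ 4 := by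
  obtain ⟨h1, hf, hg, hn, hw⟩ := le_spread f g n w
  set B := spread (f, g, n, w)
  have hB0 : 0 ≤ B := by linarith
  have hB2 : B ^ 2 ≤ B ^ 4 := pow_le_pow_right₀ h1 (by norm_num)
  have hB1 : 1 ≤ B ^ 2 := one_le_pow₀ h1
  have hBB : B ≤ B ^ 2 := le_self_pow₀ h1 (by norm_num)
  have hv : ∀ i, ‖(relayNoise M P₁ P₂ g n + w) i‖ ≤ (R * Real.sqrt β + 1) * B ^ 2 := by
    intro i
    have h2 := norm_relayNoise_le hM hβ hg hn hB0 i
    have h3 := hw i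
    have h4 := norm_add_le (relayNoise M P₁ P₂ g n i) (w i)
    rw [Pi.add_apply]
    linarith
  have hγ : noiseLevel P₁ P₂ g ≤ (1 + β * R) * B ^ 4 := by
    have h2 : ∑ j, ‖g j‖ ^ 2 ≤ ∑ _j : Fin R, B ^ 2 :=
      Finset.sum_le_sum fun j _ => pow_le_pow_left₀ (norm_nonneg _) (hg j) 2
    rw [Finset.sum_const, Finset.card_univ, Fintype.card_fin, nsmul_eq_mul] at h2
    have h3 : P₂ / (1 + P₁) * ∑ j, ‖g j‖ ^ 2 ≤ β * (R * B ^ 2) := by gcongr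
    have h4 : β * (R * B ^ 2) ≤ β * (R * B ^ 4) := by gcongr
    rw [noiseLevel]
    linarith
  have hff : ∑ j, ‖f j‖ ^ 2 ≤ R * B ^ 4 := by
    have h2 : ∑ j, ‖f j‖ ^ 2 ≤ ∑ _j : Fin R, B ^ 2 :=
      Finset.sum_le_sum fun j _ => pow_le_pow_left₀ (norm_nonneg _) (hf j) 2
    rw [Finset.sum_const, Finset.card_univ, Fintype.card_fin, nsmul_eq_mul] at h2
    exact h2.trans (by gcongr)
  have hvv : ∑ i, ‖(relayNoise M P₁ P₂ g n + w) i‖ ^ 2 ≤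
      (∑ _i : Slot R, (R * Real.sqrt β + 1) ^ 2) * B ^ 4 := by
    rw [Finset.sum_mul]
    refine Finset.sum_le_sum fun i _ => ?_
    refine (pow_le_pow_left₀ (norm_nonneg _) (hv i) 2).trans (le_of_eq ?_)
    ring
  rw [Finset.sum_mul]
  refine Finset.sum_le_sum fun i _ => ?_
  have h2 : (R * Real.sqrt β + 1) * B ^ 2 ≤ (R * Real.sqrt β + 1) * B ^ 4 := by gcongr
  have := hv i
  linarith

/-- The integrable majorant of the error indicator. -/
def majorant {R : ℕ} (s : ℝ) (ω : Realization R) : ℝ :=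
  (∏ j, ((1 + ‖ω.1 j‖) ^ (8 * R) * ‖ω.1 j‖ ^ (-s))) *
    ((∏ j, ((1 + ‖ω.2.1 j‖) ^ (8 * R) * ‖ω.2.1 j‖ ^ (-s))) *
    ((∏ j, ∏ i, ((1 + ‖ω.2.2.1 j i‖) ^ (8 * R) * ‖ω.2.2.1 j i‖ ^ (-0 : ℝ))) *
      ∏ i, ((1 + ‖ω.2.2.2 i‖) ^ (8 * R) * ‖ω.2.2.2 i‖ ^ (-0 : ℝ))))

theorem majorant_eq {R : ℕ} (s : ℝ) (ω : Realization R) :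
    majorant s ω = spread ω ^ (8 * R) * ∏ j, (‖ω.1 j‖ ^ (-s) * ‖ω.2.1 j‖ ^ (-s)) := by
  simp only [majorant, spread, neg_zero, Real.rpow_zero, mul_one, Finset.prod_mul_distrib,
    Finset.prod_pow, mul_pow]
  ring

theorem integrable_majorant (R : ℕ) {s : ℝ} (hs : s < 2) :
    Integrable (majorant s) (channelLaw R) := by
  have h1 := integrable_one_add_pow_mul_rpow_cscg (8 * R) hs
  -- The noise factors of `majorant` carry the exponent `-0` so that this instance matches them
  -- literally.
  have h0 := integrable_one_add_pow_mul_rpow_cscg (8 * R) (s := 0) (by norm_num)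
  refine (Integrable.fintype_prod fun _ => h1).mul_prod
    ((Integrable.fintype_prod fun _ => h1).mul_prod
      (Integrable.mul_prod (f := fun n : Fin R → Slot R → ℂ =>
        ∏ j, ∏ i, ((1 + ‖n j i‖) ^ (8 * R) * ‖n j i‖ ^ (-0 : ℝ)))
        (Integrable.fintype_prod fun _ => Integrable.fintype_prod fun _ => h0)
        (Integrable.fintype_prod fun _ => h0)))

instance : NullSingletonClass cscg := by
  rw [cscg]; infer_instance

instance (R : ℕ) : IsProbabilityMeasure (channelLaw R) := by
  rw [channelLaw]; infer_instance

theorem ae_fading_ne_zero (R : ℕ) :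
    ∀ᵐ ω ∂channelLaw R, ∀ j, ω.1 j ≠ 0 ∧ ω.2.1 j ≠ 0 := by
  have h : ∀ᵐ f : Fin R → ℂ ∂Measure.pi fun _ => cscg, ∀ j, f j ≠ 0 :=
    ae_all_iff.mpr fun j => Measure.ae_eval_ne _ j 0
  have h1 : ∀ᵐ ω ∂channelLaw R, ∀ j, ω.1 j ≠ 0 := Measure.quasiMeasurePreserving_fst.ae h
  have h2 : ∀ᵐ ω ∂channelLaw R, ∀ j, ω.2.1 j ≠ 0 :=
    Measure.quasiMeasurePreserving_snd.ae (Measure.quasiMeasurePreserving_fst.ae h)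
  filter_upwards [h1, h2] with ω hω1 hω2 j using ⟨hω1 j, hω2 j⟩

theorem rpow_le_majorant {R : ℕ} {s γ C : ℝ} (hs0 : 0 < s) (hs : s < 2) (hγ : 0 ≤ γ) (hC : 0 ≤ C)
    (ω : Realization R) (hω : ∀ j, ω.1 j ≠ 0 ∧ ω.2.1 j ≠ 0)
    (h : ∀ j, γ * (‖ω.1 j‖ * ‖ω.2.1 j‖) ≤ C * spread ω ^ 4) :
    (γ ^ s) ^ R ≤ (C ^ s) ^ R * majorant s ω := by
  have hB : 1 ≤ spread ω := (le_spread ω.1 ω.2.1 ω.2.2.1 ω.2.2.2).1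
  have hj : ∀ j, γ ^ s ≤ C ^ s * spread ω ^ 8 * (‖ω.1 j‖ ^ (-s) * ‖ω.2.1 j‖ ^ (-s)) := by
    intro j
    have hf : 0 < ‖ω.1 j‖ := norm_pos_iff.mpr (hω j).1
    have hg : 0 < ‖ω.2.1 j‖ := norm_pos_iff.mpr (hω j).2
    have h1 := Real.rpow_le_rpow (by positivity) (h j) hs0.le
    rw [Real.mul_rpow hγ (by positivity), Real.mul_rpow hf.le hg.le,
      Real.mul_rpow hC (by positivity)] at h1
    -- Rounding `s` up to `2` gives an integer power; over the `R` factors this produces the `8 * R`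
    -- in `majorant`.
    have h2 : (spread ω ^ 4) ^ s ≤ spread ω ^ 8 := by
      have h3 : (spread ω ^ 4) ^ s ≤ (spread ω ^ 4) ^ (2 : ℝ) :=
        Real.rpow_le_rpow_of_exponent_le (one_le_pow₀ hB) hs.le
      rw [Real.rpow_two, ← pow_mul] at h3
      exact h3
    have hf' : 0 < ‖ω.1 j‖ ^ s := by positivity
    have hg' : 0 < ‖ω.2.1 j‖ ^ s := by positivity
    rw [Real.rpow_neg hf.le, Real.rpow_neg hg.le, ← mul_inv, ← div_eq_mul_inv,
      le_div_iff₀ (by positivity)]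
    exact h1.trans (by gcongr)
  calc (γ ^ s) ^ R = ∏ _j : Fin R, γ ^ s := by simp
    _ ≤ ∏ j, (C ^ s * spread ω ^ 8 * (‖ω.1 j‖ ^ (-s) * ‖ω.2.1 j‖ ^ (-s))) :=
        Finset.prod_le_prod (fun _ _ => by positivity) fun j _ => hj j
    _ = _ := by
        rw [majorant_eq, Finset.prod_mul_distrib, Finset.prod_const, Finset.card_univ,
          Fintype.card_fin, mul_pow, ← pow_mul, mul_assoc]

theorem exists_errorProb_le {R L : ℕ} (u : Slot R → ℤ) {M : Matrix (Fin R) (Fin R) ℂ}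
    (hM : IsGBH M)
    (hdet : ∀ k m : Fin L, k ≠ m →
      (Matrix.fromCols (codeword u M k) (codeword u M m)).det ≠ 0)
    {β s : ℝ} (hβ0 : 0 ≤ β) (hs0 : 0 < s) (hs : s < 2) :
    ∃ K : ℝ, 0 ≤ K ∧ ∀ (P₁ P₂ : ℝ), 0 ≤ P₁ → 0 ≤ P₂ → P₂ / (1 + P₁) ≤ β →
      ∀ dec : (Fin R → ℂ) → (Slot R → ℂ) → Fin L, IsMLDecoder u M P₁ P₂ dec → ∀ k : Fin L,
        (gain R P₁ P₂ ^ s) ^ R *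
          (channelLaw R).real {ω | dec ω.2.1 (received u M P₁ P₂ k ω) ≠ k} ≤ K := by
  obtain ⟨C, hC0, hC⟩ := exists_gain_mul_le u M hdet
  set D : ℝ := ∑ _i : Slot R, ((1 + β * R) + (R + ∑ _i : Slot R, (R * Real.sqrt β + 1) ^ 2) +
    (R * Real.sqrt β + 1)) with hD
  have hD0 : 0 ≤ D := by positivity
  have hF0 : ∀ ω : Realization R, 0 ≤ ((C * D) ^ s) ^ R * majorant s ω := by
    intro ω
    have : 0 ≤ spread ω := zero_le_one.trans (le_spread ω.1 ω.2.1 ω.2.2.1 ω.2.2.2).1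
    rw [majorant_eq]
    positivity
  refine ⟨∫ ω, ((C * D) ^ s) ^ R * majorant s ω ∂channelLaw R, integral_nonneg hF0, ?_⟩
  intro P₁ P₂ h₁ h₂ hβ dec hdec k
  have hγ := gain_nonneg R P₁ P₂
  refine le_trans ?_ (mul_meas_ge_le_integral_of_nonneg (Filter.Eventually.of_forall hF0)
    ((integrable_majorant R hs).const_mul _) ((gain R P₁ P₂ ^ s) ^ R))
  refine mul_le_mul_of_nonneg_left ?_ (by positivity)
  refine ENNReal.toReal_mono (measure_ne_top _ _) (measure_mono_ae ?_)
  filter_upwards [ae_fading_ne_zero R] with ω hω herr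
  refine rpow_le_majorant hs0 hs hγ (by positivity) ω hω fun j => ?_
  obtain ⟨f, g, n, w⟩ := ω
  have h3 := hC P₁ P₂ h₁ h₂ f g (relayNoise M P₁ P₂ g n + w) _ k _ (Ne.symm herr)
    ((received_eq u M P₁ P₂ k f g n w).trans (add_assoc _ _ _)) (hdec.isMax g _ k) j
  refine h3.trans ?_
  rw [mul_assoc]
  exact mul_le_mul_of_nonneg_left (noise_sum_le hM hβ0 hβ f g n w) hC0

/-! ### Lower bounds for the error probability -/

theorem smul_volume_le_cscg (r : ℝ) (s : Set ℂ) :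
    ENNReal.ofReal (Real.pi⁻¹ * Real.exp (-r ^ 2)) * volume (Metric.closedBall 0 r ∩ s) ≤
      cscg s := by
  have h : (volume.restrict (Metric.closedBall (0 : ℂ) r)).withDensity
      (fun _ => ENNReal.ofReal (Real.pi⁻¹ * Real.exp (-r ^ 2))) ≤ cscg := by
    rw [← withDensity_indicator measurableSet_closedBall, cscg]
    refine withDensity_mono (Filter.Eventually.of_forall fun z => ?_)
    refine Set.indicator_apply_le' (fun hz => ?_) (fun _ => zero_le)
    rw [mem_closedBall_zero_iff] at hz
    have : ‖z‖ ^ 2 ≤ r ^ 2 := pow_le_pow_left₀ (norm_nonneg _) hz 2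
    refine ENNReal.ofReal_le_ofReal ?_
    gcongr
  have h2 := h s
  rw [withDensity_const, Measure.smul_apply, smul_eq_mul] at h2
  refine le_trans (mul_le_mul_right ?_ _) h2
  rw [Set.inter_comm]
  exact Measure.le_restrict_apply _ _

/-- `OuterMeasure.pi` is the largest outer measure bounded by products on boxes, so the comparison
need only be made on boxes, and `t` can be arbitrary. -/
theorem smul_volume_le_pi_cscg {ι : Type*} [Fintype ι] (r : ℝ) (t : Set (ι → ℂ)) :
    ENNReal.ofReal (Real.pi⁻¹ * Real.exp (-r ^ 2)) ^ Fintype.card ι *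
      volume ((Set.univ.pi fun _ => Metric.closedBall (0 : ℂ) r) ∩ t) ≤
      Measure.pi (fun _ : ι => cscg) t := by
  set c := ENNReal.ofReal (Real.pi⁻¹ * Real.exp (-r ^ 2))
  set B : Set (ι → ℂ) := Set.univ.pi fun _ => Metric.closedBall (0 : ℂ) r with hB
  have hBm : MeasurableSet B := MeasurableSet.univ_pi fun _ => measurableSet_closedBall
  have h : (c ^ Fintype.card ι • (volume.restrict B)).toOuterMeasure ≤
      OuterMeasure.pi fun _ : ι => cscg.toOuterMeasure := by
    rw [OuterMeasure.le_pi]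
    intro s _
    rw [Measure.coe_toOuterMeasure, Measure.smul_apply, Measure.restrict_apply' hBm, hB,
      ← Set.pi_inter_distrib, volume_pi_pi, smul_eq_mul, Finset.card_univ.symm,
      ← Finset.prod_const, ← Finset.prod_mul_distrib]
    refine Finset.prod_le_prod' fun i _ => ?_
    rw [Set.inter_comm]
    exact smul_volume_le_cscg r (s i)
  have h2 := h t
  rw [Measure.coe_toOuterMeasure, Measure.smul_apply, Measure.restrict_apply' hBm,
    Set.inter_comm, smul_eq_mul] at h2
  refine h2.trans ?_
  rw [Measure.pi_def]
  exact le_toMeasure_apply _ _ _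

/-- Two hypotheses whose means are at bounded distance cannot be told apart reliably in Gaussian
noise. -/
theorem exists_two_point_bound (ι : Type*) [Fintype ι] {C : ℝ} (hC : 0 ≤ C) :
    ∃ c : ENNReal, c ≠ 0 ∧ ∀ (A₁ A₂ : Set (ι → ℂ)), A₁ ∪ A₂ = Set.univ → ∀ T T' : ι → ℂ,
      (∀ i, ‖T i - T' i‖ ≤ C) →
      c ≤ Measure.pi (fun _ : ι => cscg) {w | T + w ∈ A₁} +
        Measure.pi (fun _ : ι => cscg) {w | T' + w ∈ A₂} := by
  set B : ℝ → Set (ι → ℂ) := fun r => Set.univ.pi fun _ => Metric.closedBall (0 : ℂ) r with hB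
  have hmem : ∀ r w, w ∈ B r ↔ ∀ i, ‖w i‖ ≤ r := by
    intro r w
    simp [hB, Set.mem_pi]
  set c := ENNReal.ofReal (Real.pi⁻¹ * Real.exp (-(C + 1) ^ 2)) ^ Fintype.card ι
  have hc : c ≠ 0 := by
    refine pow_ne_zero _ ?_
    rw [ne_eq, ENNReal.ofReal_eq_zero, not_le]
    positivity
  have hv : volume (B 1) ≠ 0 := by
    rw [hB, volume_pi_pi]
    refine Finset.prod_ne_zero_iff.mpr fun i _ => ?_
    exact (Metric.measure_closedBall_pos _ _ one_pos).ne'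
  refine ⟨c * volume (B 1), mul_ne_zero hc hv, fun A₁ A₂ hA T T' hT => ?_⟩
  have h1 : c * volume (B 1 ∩ {w | T + w ∈ A₁}) ≤
      Measure.pi (fun _ : ι => cscg) {w | T + w ∈ A₁} := by
    refine le_trans ?_ (smul_volume_le_pi_cscg (C + 1) _)
    gcongr
    intro w hw
    rw [hmem] at hw
    exact (hmem _ _).mpr fun i => (hw i).trans (by linarith)
  have h2 : c * volume (B 1 ∩ {w | T + w ∈ A₂}) ≤
      Measure.pi (fun _ : ι => cscg) {w | T' + w ∈ A₂} := by
    refine le_trans ?_ (smul_volume_le_pi_cscg (C + 1) _)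
    -- Translation by `T - T'` turns `T' + w` into `T + w` and moves the polydisc of radius `1` into
    -- that of radius `C + 1`.
    rw [← measure_preimage_add_right volume (T - T') (_ ∩ {w | T' + w ∈ A₂})]
    gcongr
    rintro w ⟨hw, hwA⟩
    refine ⟨(hmem _ _).mpr fun i => ?_, ?_⟩
    · have h3 := (hmem _ _).mp hw i
      have h4 := norm_add_le (w i) (T i - T' i)
      have h5 := hT i
      simp only [Pi.add_apply, Pi.sub_apply]
      linarith
    · have : T' + (w + (T - T')) = T + w := by abel
      simpa [this] using hwA
  refine le_trans ?_ (add_le_add h1 h2)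
  rw [← mul_add]
  gcongr
  refine le_trans (measure_mono fun w hw => ?_) (measure_union_le _ _)
  have : T + w ∈ A₁ ∪ A₂ := hA ▸ Set.mem_univ _
  rcases this with h | h
  · exact Or.inl ⟨hw, h⟩
  · exact Or.inr ⟨hw, h⟩

/-! ### Conditioning on the fading, and rotation invariance. -/

theorem lintegral_channelLaw {R : ℕ} {F : Realization R → ENNReal} (hF : Measurable F) :
    ∫⁻ ω, F ω ∂channelLaw R =
      ∫⁻ x, ∫⁻ n, ∫⁻ w, F (x.1, x.2, n, w) ∂(Measure.pi fun _ => cscg)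
        ∂(Measure.pi fun _ => Measure.pi fun _ => cscg)
        ∂((Measure.pi fun _ => cscg).prod (Measure.pi fun _ => cscg)) := by
  have hm : Measurable fun y : ((Fin R → ℂ) × (Fin R → ℂ)) × (Fin R → Slot R → ℂ) × (Slot R → ℂ) =>
      F (y.1.1, y.1.2, y.2) := hF.comp (by fun_prop)
  have hp := measurePreserving_prodAssoc (Measure.pi fun _ : Fin R => cscg)
    (Measure.pi fun _ : Fin R => cscg)
    ((Measure.pi fun _ : Fin R => Measure.pi fun _ : Slot R => cscg).prod
      (Measure.pi fun _ : Slot R => cscg))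
  rw [channelLaw, ← hp.lintegral_comp hF]
  refine (lintegral_prod _ hm.aemeasurable).trans (lintegral_congr fun x => ?_)
  exact lintegral_prod _ (hF.comp (by fun_prop)).aemeasurable

theorem measurable_received {R L : ℕ} (u : Slot R → ℤ) (M : Matrix (Fin R) (Fin R) ℂ) (P₁ P₂ : ℝ)
    (k : Fin L) : Measurable (received u M P₁ P₂ k) := by
  have h : received u M P₁ P₂ k = fun ω : Realization R =>
      (gain R P₁ P₂ : ℂ) • codeword u M k *ᵥ (ω.1 * ω.2.1) +
        relayNoise M P₁ P₂ ω.2.1 ω.2.2.1 + ω.2.2.2 := by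
    funext ω
    exact received_eq u M P₁ P₂ k ω.1 ω.2.1 ω.2.2.1 ω.2.2.2
  rw [h]
  refine measurable_pi_lambda _ fun i => ?_
  simp only [Pi.add_apply, Pi.smul_apply, relayNoise, Matrix.mulVec, dotProduct, Pi.mul_apply]
  fun_prop

theorem measurableSet_error {R L : ℕ} (u : Slot R → ℤ) (M : Matrix (Fin R) (Fin R) ℂ) (P₁ P₂ : ℝ)
    {dec : (Fin R → ℂ) → (Slot R → ℂ) → Fin L}
    (hdec : Measurable fun z : (Fin R → ℂ) × (Slot R → ℂ) => dec z.1 z.2) (k : Fin L) :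
    MeasurableSet {ω | dec ω.2.1 (received u M P₁ P₂ k ω) ≠ k} := by
  have h : Measurable fun ω : Realization R => dec ω.2.1 (received u M P₁ P₂ k ω) :=
    hdec.comp ((measurable_snd.fst).prodMk (measurable_received u M P₁ P₂ k))
  exact h (MeasurableSet.of_discrete (s := {k}ᶜ))

theorem measurePreserving_mul_cscg {z : ℂ} (hz : ‖z‖ = 1) :
    MeasurePreserving (fun x : ℂ => z * x) cscg cscg := by
  have hz0 : z ≠ 0 := norm_ne_zero_iff.mp (by rw [hz]; exact one_ne_zero)
  have hvol : MeasurePreserving (fun x : ℂ => z * x) volume volume := by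
    have := (rotation ⟨z, mem_sphere_zero_iff_norm.mpr hz⟩ : ℂ ≃ₗᵢ[ℝ] ℂ).measurePreserving
    exact this
  refine ⟨by fun_prop, Measure.ext fun s hs => ?_⟩
  rw [Measure.map_apply (by fun_prop) hs, cscg, withDensity_apply _ hs,
    withDensity_apply _ (hvol.measurable hs)]
  rw [← hvol.setLIntegral_comp_preimage hs (by fun_prop)]
  simp [hz]

theorem measurePreserving_rotate {R : ℕ} {z : ℂ} (hz : ‖z‖ = 1) :
    MeasurePreserving (fun ω : Realization R => (z • ω.1, ω.2)) (channelLaw R) (channelLaw R) := by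
  have h : MeasurePreserving (fun f : Fin R → ℂ => z • f) (Measure.pi fun _ => cscg)
      (Measure.pi fun _ => cscg) :=
    measurePreserving_pi _ _ fun _ => measurePreserving_mul_cscg hz
  exact h.prod (MeasurePreserving.id _)

/-- Replacing `f` by `z f` under message `m` does not change its error probability. Given `f`, `g`
and the relay noise, the two means then differ only by the quantity bounded on `K`, since the relay
noise cancels. A decision cannot equal both `n` and `m`, so the two-point bound applies. -/
theorem exists_error_lower_bound (R : ℕ) {C : ℝ} (hC : 0 ≤ C) :
    ∃ c : ENNReal, c ≠ 0 ∧ ∀ (L : ℕ) (u : Slot R → ℤ) (M : Matrix (Fin R) (Fin R) ℂ) (P₁ P₂ : ℝ)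
      (dec : (Fin R → ℂ) → (Slot R → ℂ) → Fin L),
      (Measurable fun z : (Fin R → ℂ) × (Slot R → ℂ) => dec z.1 z.2) →
      ∀ (n m : Fin L), n ≠ m → ∀ z : ℂ, ‖z‖ = 1 → ∀ K : Set ((Fin R → ℂ) × (Fin R → ℂ)),
      MeasurableSet K →
      (∀ x ∈ K, ∀ i, ‖(gain R P₁ P₂ : ℂ) * ((codeword u M n *ᵥ (x.1 * x.2)) i -
        z * (codeword u M m *ᵥ (x.1 * x.2)) i)‖ ≤ C) →
      c * ((Measure.pi fun _ => cscg).prod (Measure.pi fun _ => cscg)) K ≤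
        channelLaw R {ω | dec ω.2.1 (received u M P₁ P₂ n ω) ≠ n} +
        channelLaw R {ω | dec ω.2.1 (received u M P₁ P₂ m ω) ≠ m} := by
  obtain ⟨c, hc0, hc⟩ := exists_two_point_bound (Slot R) hC
  refine ⟨c, hc0, ?_⟩
  intro L u M P₁ P₂ dec hdec n m hnm z hz K hK hKC
  set E₁ := {ω : Realization R | dec ω.2.1 (received u M P₁ P₂ n ω) ≠ n}
  set E₂ := {ω : Realization R | dec ω.2.1 (received u M P₁ P₂ m ω) ≠ m}
  have hE₁ : MeasurableSet E₁ := measurableSet_error u M P₁ P₂ hdec n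
  have hE₂ : MeasurableSet E₂ := measurableSet_error u M P₁ P₂ hdec m
  have hrot := measurePreserving_rotate (R := R) hz
  set E₃ := (fun ω : Realization R => (z • ω.1, ω.2)) ⁻¹' E₂ with hE₃def
  have hE₃ : MeasurableSet E₃ := hrot.measurable hE₂
  rw [← hrot.measure_preimage hE₂.nullMeasurableSet, ← lintegral_indicator_one hE₁,
    ← lintegral_indicator_one hE₃, ← lintegral_add_left (measurable_one.indicator hE₁),
    lintegral_channelLaw (F := fun ω => E₁.indicator 1 ω + E₃.indicator 1 ω)
      ((measurable_one.indicator hE₁).add (measurable_one.indicator hE₃)),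
    ← lintegral_indicator_const hK]
  refine lintegral_mono fun x => ?_
  refine Set.indicator_apply_le' (fun hx => ?_) (fun _ => zero_le)
  obtain ⟨f, g⟩ := x
  have hpt : ∀ ν : Fin R → Slot R → ℂ, c ≤ ∫⁻ w, (E₁.indicator 1 (f, g, ν, w) +
      E₃.indicator 1 (f, g, ν, w) : ENNReal) ∂(Measure.pi fun _ => cscg) := by
    intro ν
    have hsec : Measurable fun w : Slot R → ℂ => ((f, g, ν, w) : Realization R) := by fun_prop
    have e : ∫⁻ w, (E₁.indicator 1 (f, g, ν, w) + E₃.indicator 1 (f, g, ν, w) : ENNReal)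
          ∂(Measure.pi fun _ : Slot R => cscg) =
        ∫⁻ w, E₁.indicator 1 (f, g, ν, w) ∂(Measure.pi fun _ : Slot R => cscg) +
          ∫⁻ w, E₃.indicator 1 (f, g, ν, w) ∂(Measure.pi fun _ : Slot R => cscg) :=
      lintegral_add_left ((measurable_one.indicator hE₁).comp hsec) _
    have e1 : ∫⁻ w, E₁.indicator 1 (f, g, ν, w) ∂(Measure.pi fun _ : Slot R => cscg) =
        Measure.pi (fun _ : Slot R => cscg) {w | (f, g, ν, w) ∈ E₁} :=
      lintegral_indicator_one (hsec hE₁)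
    have e3 : ∫⁻ w, E₃.indicator 1 (f, g, ν, w) ∂(Measure.pi fun _ : Slot R => cscg) =
        Measure.pi (fun _ : Slot R => cscg) {w | (f, g, ν, w) ∈ E₃} :=
      lintegral_indicator_one (hsec hE₃)
    rw [e, e1, e3]
    have h := hc {y | dec g y ≠ n} {y | dec g y ≠ m} (by
        ext y
        simp only [Set.mem_union, Set.mem_ofPred_eq, Set.mem_univ, iff_true]
        by_contra! hcon
        exact hnm (hcon.1.symm.trans hcon.2))
      ((gain R P₁ P₂ : ℂ) • codeword u M n *ᵥ (f * g) + relayNoise M P₁ P₂ g ν)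
      ((gain R P₁ P₂ : ℂ) • codeword u M m *ᵥ ((z • f) * g) + relayNoise M P₁ P₂ g ν)
      (fun i => by
        refine le_trans (le_of_eq ?_) (hKC (f, g) hx i)
        congr 1
        simp only [Pi.add_apply, Pi.smul_apply, smul_eq_mul, smul_mul_assoc, Matrix.mulVec_smul]
        ring)
    refine h.trans (le_of_eq ?_)
    simp only [E₁, hE₃def, E₂, Set.mem_ofPred_eq, Set.mem_preimage, received_eq]
  calc c = ∫⁻ _ν, c ∂(Measure.pi fun _ : Fin R => Measure.pi fun _ : Slot R => cscg) := by simp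
    _ ≤ _ := lintegral_mono hpt

/-! ### Probability of bad fading. -/

theorem le_cscg_closedBall {c : ℂ} {δ : ℝ} (hc : ‖c‖ ≤ 2) (hδ0 : 0 ≤ δ) (hδ : δ ≤ 1) :
    ENNReal.ofReal (Real.exp (-9) * δ ^ 2) ≤ cscg (Metric.closedBall c δ) := by
  have h := smul_volume_le_cscg 3 (Metric.closedBall c δ)
  -- The disc lies within radius `3` of the origin, whence the density bound `π⁻¹ exp (-9)`.
  have hsub : Metric.closedBall c δ ⊆ Metric.closedBall 0 3 := by
    refine Metric.closedBall_subset_closedBall' ?_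
    rw [dist_zero_right]
    linarith
  rw [Set.inter_eq_right.mpr hsub, Complex.volume_closedBall] at h
  refine le_trans (le_of_eq ?_) h
  rw [← ENNReal.ofReal_pow hδ0, ← ENNReal.ofReal_coe_nnreal, ← ENNReal.ofReal_mul (by positivity),
    ← ENNReal.ofReal_mul (by positivity), NNReal.coe_real_pi]
  congr 1
  have := Real.pi_ne_zero
  field_simp
  norm_num [mul_comm]

/-- The probability that the fading coefficients lie near a line. -/
theorem le_pi_cscg_tube {r : ℕ} (κ : Fin r → ℂ) (hκ : ∀ j, ‖κ j‖ ≤ 2) {ρ δ : ℝ} (hρ0 : 0 ≤ ρ)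
    (hρ : ρ ≤ 1) (hδ0 : 0 ≤ δ) (hδ : δ ≤ 1) :
    ENNReal.ofReal (Real.exp (-9) * ρ ^ 2) * ENNReal.ofReal (Real.exp (-9) * δ ^ 2) ^ r ≤
      Measure.pi (fun _ : Fin (r + 1) => cscg)
        {f | ‖f 0‖ ≤ ρ ∧ ∀ j : Fin r, ‖f j.succ - κ j * f 0‖ ≤ δ} := by
  set S : Set (ℂ × (Fin r → ℂ)) := {x | ‖x.1‖ ≤ ρ ∧ ∀ j : Fin r, ‖x.2 j - κ j * x.1‖ ≤ δ} with hS
  have hSm : MeasurableSet S := by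
    refine IsClosed.measurableSet ?_
    rw [hS, Set.ofPred_and, Set.ofPred_forall]
    refine (isClosed_le (by fun_prop) continuous_const).inter
      (isClosed_iInter fun j => isClosed_le (by fun_prop) continuous_const)
  have hp := measurePreserving_piFinSuccAbove (fun _ : Fin (r + 1) => cscg) 0
  have h1 := hp.measure_preimage hSm.nullMeasurableSet
  have h2 : (MeasurableEquiv.piFinSuccAbove (fun _ : Fin (r + 1) => ℂ) 0) ⁻¹' S =
      {f | ‖f 0‖ ≤ ρ ∧ ∀ j : Fin r, ‖f j.succ - κ j * f 0‖ ≤ δ} := by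
    ext f
    simp [hS, MeasurableEquiv.piFinSuccAbove, Fin.insertNthEquiv, Fin.tail]
  rw [← h2, h1, Measure.prod_apply hSm]
  calc ENNReal.ofReal (Real.exp (-9) * ρ ^ 2) * ENNReal.ofReal (Real.exp (-9) * δ ^ 2) ^ r
      ≤ ENNReal.ofReal (Real.exp (-9) * δ ^ 2) ^ r * cscg (Metric.closedBall 0 ρ) := by
        rw [mul_comm]
        gcongr
        exact le_cscg_closedBall (by simp) hρ0 hρ
    _ = ∫⁻ x, (Metric.closedBall 0 ρ).indicator
          (fun _ => ENNReal.ofReal (Real.exp (-9) * δ ^ 2) ^ r) x ∂cscg :=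
        (lintegral_indicator_const measurableSet_closedBall _).symm
    _ ≤ _ := by
        refine lintegral_mono fun x => ?_
        refine Set.indicator_apply_le' (fun hx => ?_) (fun _ => zero_le)
        rw [mem_closedBall_zero_iff] at hx
        have h3 : Prod.mk x ⁻¹' S = Set.univ.pi fun j => Metric.closedBall (κ j * x) δ := by
          ext y
          simp [hS, Set.mem_pi, hx, dist_eq_norm]
        rw [h3, Measure.pi_pi]
        calc ENNReal.ofReal (Real.exp (-9) * δ ^ 2) ^ r
            = ∏ _j : Fin r, ENNReal.ofReal (Real.exp (-9) * δ ^ 2) := by simp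
          _ ≤ _ := Finset.prod_le_prod' fun j _ => le_cscg_closedBall (by
              rw [norm_mul]
              nlinarith [hκ j, norm_nonneg (κ j), norm_nonneg x]) hδ0 hδ

/-- Pairs `(f, g)` with `g` near a fixed point and `f` near a line depending on `g`. -/
def tube {r : ℕ} (κ : Fin r → ℂ) (ρ δ : ℝ) : Set ((Fin (r + 1) → ℂ) × (Fin (r + 1) → ℂ)) :=
  {x | (∀ j, x.2 j ∈ Metric.closedBall (3 / 2 : ℂ) (1 / 2)) ∧ ‖x.1 0‖ ≤ ρ ∧
    ∀ j : Fin r, ‖x.1 j.succ - κ j * (x.2 0 / x.2 j.succ) * x.1 0‖ ≤ δ}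

theorem measurableSet_tube {r : ℕ} (κ : Fin r → ℂ) (ρ δ : ℝ) : MeasurableSet (tube κ ρ δ) := by
  simp only [tube, Set.ofPred_and, Set.ofPred_forall]
  refine (MeasurableSet.iInter fun j => ?_).inter
    ((measurableSet_le (by fun_prop) measurable_const).inter
      (MeasurableSet.iInter fun j => measurableSet_le (by fun_prop) measurable_const))
  exact (show Measurable fun x : (Fin (r + 1) → ℂ) × (Fin (r + 1) → ℂ) => x.2 j by fun_prop)
    measurableSet_closedBall

theorem norm_mem_of_mem_closedBall {z : ℂ} (hz : z ∈ Metric.closedBall (3 / 2 : ℂ) (1 / 2)) :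
    1 ≤ ‖z‖ ∧ ‖z‖ ≤ 2 := by
  rw [mem_closedBall_iff_norm] at hz
  have h1 := norm_sub_norm_le (3 / 2 : ℂ) z
  have h2 := norm_sub_norm_le z (3 / 2 : ℂ)
  have h3 : ‖(3 / 2 : ℂ)‖ = 3 / 2 := by norm_num
  rw [norm_sub_rev] at h1
  constructor <;> linarith

theorem le_prod_tube {r : ℕ} (κ : Fin r → ℂ) (hκ : ∀ j, ‖κ j‖ ≤ 1) {ρ δ : ℝ} (hρ0 : 0 ≤ ρ)
    (hρ : ρ ≤ 1) (hδ0 : 0 ≤ δ) (hδ : δ ≤ 1) :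
    ENNReal.ofReal (Real.exp (-9) * ρ ^ 2) * ENNReal.ofReal (Real.exp (-9) * δ ^ 2) ^ r *
      ENNReal.ofReal (Real.exp (-9) * (1 / 2) ^ 2) ^ (r + 1) ≤
      ((Measure.pi fun _ => cscg).prod (Measure.pi fun _ => cscg)) (tube κ ρ δ) := by
  rw [Measure.prod_apply_symm (measurableSet_tube κ ρ δ)]
  set c := ENNReal.ofReal (Real.exp (-9) * ρ ^ 2) * ENNReal.ofReal (Real.exp (-9) * δ ^ 2) ^ r
  set B : Set (Fin (r + 1) → ℂ) := Set.univ.pi fun _ => Metric.closedBall (3 / 2 : ℂ) (1 / 2)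
    with hB
  have hBm : MeasurableSet B := MeasurableSet.univ_pi fun _ => measurableSet_closedBall
  calc c * ENNReal.ofReal (Real.exp (-9) * (1 / 2) ^ 2) ^ (r + 1)
      ≤ c * Measure.pi (fun _ => cscg) B := by
        gcongr
        rw [hB, Measure.pi_pi]
        calc ENNReal.ofReal (Real.exp (-9) * (1 / 2) ^ 2) ^ (r + 1)
            = ∏ _j : Fin (r + 1), ENNReal.ofReal (Real.exp (-9) * (1 / 2) ^ 2) := by simp
          _ ≤ _ := Finset.prod_le_prod' fun j _ =>
              le_cscg_closedBall (by norm_num) (by norm_num) (by norm_num)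
    _ = ∫⁻ g, B.indicator (fun _ => c) g ∂(Measure.pi fun _ => cscg) :=
        (lintegral_indicator_const hBm _).symm
    _ ≤ _ := by
        refine lintegral_mono fun g => ?_
        refine Set.indicator_apply_le' (fun hg => ?_) (fun _ => zero_le)
        rw [hB, Set.mem_univ_pi] at hg
        refine (le_pi_cscg_tube (fun j => κ j * (g 0 / g j.succ)) (fun j => ?_) hρ0 hρ hδ0
          hδ).trans (measure_mono fun f hf => ⟨hg, hf⟩)
        have h0 := norm_mem_of_mem_closedBall (hg 0)
        have hj := norm_mem_of_mem_closedBall (hg j.succ)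
        rw [norm_mul, norm_div]
        -- All `|g_j|` lie in `[1, 2]`, so the slopes stay within the bound required by
        -- `le_pi_cscg_tube`.
        have h1 : ‖g 0‖ / ‖g j.succ‖ ≤ 2 := by
          rw [div_le_iff₀ (by linarith)]
          linarith
        have h2 : 0 ≤ ‖g 0‖ / ‖g j.succ‖ := by positivity
        nlinarith [hκ j, norm_nonneg (κ j)]

theorem blockErrorProb_ge_pair {R L : ℕ} (u : Slot R → ℤ) (M : Matrix (Fin R) (Fin R) ℂ)
    (P₁ P₂ : ℝ) (dec : (Fin R → ℂ) → (Slot R → ℂ) → Fin L) {n m : Fin L} (hnm : n ≠ m) :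
    (1 / L : ℝ) * ((channelLaw R).real {ω | dec ω.2.1 (received u M P₁ P₂ n ω) ≠ n} +
      (channelLaw R).real {ω | dec ω.2.1 (received u M P₁ P₂ m ω) ≠ m}) ≤
      blockErrorProb u M P₁ P₂ dec := by
  rw [blockErrorProb]
  refine mul_le_mul_of_nonneg_left ?_ (by positivity)
  rw [← Finset.sum_pair (f := fun k => (channelLaw R).real
    {ω | dec ω.2.1 (received u M P₁ P₂ k ω) ≠ k}) hnm]
  exact Finset.sum_le_sum_of_subset_of_nonneg (Finset.subset_univ _)
    fun _ _ _ => measureReal_nonneg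

theorem exists_le_blockErrorProb {r L : ℕ} (u : Slot (r + 1) → ℤ)
    (M : Matrix (Fin (r + 1)) (Fin (r + 1)) ℂ) {n m : Fin L} (hnm : n ≠ m) {z : ℂ} (hz : ‖z‖ = 1)
    {κ : Fin r → ℂ} (hκ : ∀ j, ‖κ j‖ ≤ 1) {C : ℝ} (hC : 0 ≤ C) :
    ∃ c : ℝ, 0 < c ∧ ∀ (P₁ P₂ ρ δ : ℝ) (dec : (Fin (r + 1) → ℂ) → (Slot (r + 1) → ℂ) → Fin L),
      (Measurable fun z : (Fin (r + 1) → ℂ) × (Slot (r + 1) → ℂ) => dec z.1 z.2) →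
      0 ≤ ρ → ρ ≤ 1 → 0 ≤ δ → δ ≤ 1 →
      (∀ x ∈ tube κ ρ δ, ∀ i, ‖(gain (r + 1) P₁ P₂ : ℂ) *
        ((codeword u M n *ᵥ (x.1 * x.2)) i - z * (codeword u M m *ᵥ (x.1 * x.2)) i)‖ ≤ C) →
      c * (ρ ^ 2 * (δ ^ 2) ^ r) ≤ blockErrorProb u M P₁ P₂ dec := by
  obtain ⟨c, hc0, hc⟩ := exists_error_lower_bound (r + 1) hC
  -- Truncation at `1` keeps the constant finite for the passage to real numbers.
  have hcm0 : min c 1 ≠ 0 := by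
    rw [← pos_iff_ne_zero, lt_min_iff]
    exact ⟨pos_iff_ne_zero.mpr hc0, one_pos⟩
  have hcmT : min c 1 ≠ ⊤ := ne_top_of_le_ne_top ENNReal.one_ne_top (min_le_right _ _)
  have hL : (0 : ℝ) < L := by exact_mod_cast n.pos
  set d := (min c 1).toReal
  have hd : 0 < d := ENNReal.toReal_pos hcm0 hcmT
  refine ⟨1 / L * (d * (Real.exp (-9) * Real.exp (-9) ^ r *
    (Real.exp (-9) * (1 / 2) ^ 2) ^ (r + 1))), by positivity, ?_⟩
  intro P₁ P₂ ρ δ dec hdec hρ0 hρ hδ0 hδ hK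
  have h1 := hc L u M P₁ P₂ dec hdec n m hnm z hz _ (measurableSet_tube κ ρ δ) hK
  have h2 := (mul_le_mul' (min_le_left c 1) (le_prod_tube κ hκ hρ0 hρ hδ0 hδ)).trans h1
  rw [← ENNReal.ofReal_toReal hcmT, ← ENNReal.ofReal_pow (by positivity),
    ← ENNReal.ofReal_pow (by positivity), ← ENNReal.ofReal_mul (by positivity),
    ← ENNReal.ofReal_mul (by positivity), ← ENNReal.ofReal_mul (by positivity),
    ← ofReal_measureReal (measure_ne_top _ _), ← ofReal_measureReal (measure_ne_top _ _),
    ← ENNReal.ofReal_add measureReal_nonneg measureReal_nonneg,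
    ENNReal.ofReal_le_ofReal_iff (add_nonneg measureReal_nonneg measureReal_nonneg)] at h2
  refine le_trans ?_ (blockErrorProb_ge_pair u M P₁ P₂ dec hnm)
  refine le_trans (le_of_eq ?_) (mul_le_mul_of_nonneg_left h2 (by positivity : 0 ≤ 1 / (L : ℝ)))
  rw [mul_pow]
  ring

theorem norm_codeword_mulVec_le {R L : ℕ} (hR : 1 ≤ R) {M : Matrix (Fin R) (Fin R) ℂ}
    (hM : IsGBH M) (u : Slot R → ℤ) (k : Fin L) {d : Fin R → ℂ} {δ : ℝ} (hd : ∀ j, ‖d j‖ ≤ δ)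
    (i : Slot R) : ‖(codeword u M k *ᵥ d) i‖ ≤ R * δ := by
  rw [Matrix.mulVec, dotProduct]
  calc ‖∑ j, codeword u M k i j * d j‖ ≤ ∑ j, ‖codeword u M k i j * d j‖ := norm_sum_le _ _
    _ ≤ ∑ _j : Fin R, δ := by
        refine Finset.sum_le_sum fun j _ => ?_
        rw [norm_mul]
        exact (mul_le_of_le_one_left (norm_nonneg _) (norm_codeword_le hR hM u k i j)).trans (hd j)
    _ = _ := by simp

/-- Since `S_n - z S_m` annihilates `a`, only the deviation `h - a` contributes: two codewords, `R`
entries of modulus at most `1`, deviation `2δ`, and `gain * δ ≤ 2`. -/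
theorem norm_gain_mul_sub_le {R L : ℕ} (hR : 1 ≤ R) {M : Matrix (Fin R) (Fin R) ℂ}
    (hM : IsGBH M) (u : Slot R → ℤ) {n m : Fin L} {z : ℂ} (hz : ‖z‖ = 1) {a : Fin R → ℂ}
    (ha : codeword u M n *ᵥ a = z • codeword u M m *ᵥ a) {P₁ P₂ δ : ℝ}
    (hδ : gain R P₁ P₂ * δ ≤ 2) {h : Fin R → ℂ} (hh : ∀ j, ‖h j - a j‖ ≤ 2 * δ) (i : Slot R) :
    ‖(gain R P₁ P₂ : ℂ) * ((codeword u M n *ᵥ h) i - z * (codeword u M m *ᵥ h) i)‖ ≤ 8 * R := by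
  have e : (codeword u M n *ᵥ h) i - z * (codeword u M m *ᵥ h) i =
      (codeword u M n *ᵥ (h - a)) i - z * (codeword u M m *ᵥ (h - a)) i := by
    have := congrFun ha i
    rw [Pi.smul_apply, smul_eq_mul] at this
    rw [Matrix.mulVec_sub, Matrix.mulVec_sub, Pi.sub_apply, Pi.sub_apply, this]
    ring
  have h1 := norm_codeword_mulVec_le hR hM u n hh i
  have h2 := norm_codeword_mulVec_le hR hM u m hh i
  have h3 := norm_sub_le ((codeword u M n *ᵥ (h - a)) i) (z * (codeword u M m *ᵥ (h - a)) i)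
  rw [norm_mul z, hz, one_mul] at h3
  have h4 : ‖(codeword u M n *ᵥ (h - a)) i - z * (codeword u M m *ᵥ (h - a)) i‖ ≤
      4 * R * δ := by
    change ‖(codeword u M n *ᵥ (h - a)) i‖ ≤ _ at h1
    change ‖(codeword u M m *ᵥ (h - a)) i‖ ≤ _ at h2
    linarith
  rw [e, norm_mul, Complex.norm_real, Real.norm_of_nonneg (gain_nonneg _ _ _)]
  have h5 := mul_le_mul_of_nonneg_left h4 (gain_nonneg R P₁ P₂)
  have h6 : gain R P₁ P₂ * δ * (4 * R) ≤ 2 * (4 * R) := by gcongr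
  linarith

/-! ### The squared gain is of order `P`. -/

theorem gain_mul_inv_sqrt_le {R : ℕ} (hR : 1 ≤ R) {α P : ℝ} (hα₀ : 0 < α) (hα₁ : α < 1)
    (hP : 1 ≤ P) : gain R (α * P) ((1 - α) * P / R) * (1 / Real.sqrt P) ≤ 2 := by
  have hR' : (0 : ℝ) < R := by exact_mod_cast hR
  have hP0 : 0 < P := by linarith
  have h1α : 0 < 1 - α := by linarith
  rw [mul_one_div, div_le_iff₀ (Real.sqrt_pos.mpr hP0)]
  refine abs_le_of_sq_le_sq' ?_ (by positivity) |>.2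
  rw [gain_sq R (by positivity) (by positivity), mul_pow, Real.sq_sqrt hP0.le,
    div_le_iff₀ (by positivity)]
  field_simp
  nlinarith [mul_pos hα₀ hP0]

theorem le_gain_sq {R : ℕ} (hR : 1 ≤ R) {α P : ℝ} (hα₀ : 0 < α) (hα₁ : α < 1) (hP : 1 ≤ P) :
    α * (1 - α) * P ≤ gain R (α * P) ((1 - α) * P / R) ^ 2 := by
  have hR' : (0 : ℝ) < R := by exact_mod_cast hR
  have hP0 : 0 < P := by linarith
  have h1α : 0 < 1 - α := by linarith
  rw [gain_sq R (by positivity) (by positivity), le_div_iff₀ (by positivity)]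
  field_simp
  nlinarith [mul_pos hα₀ hP0]

/-! ### The diversity order -/

open Filter Topology

theorem eventually_log_ratio_le {Pe : ℝ → ℝ} {c : ℝ} {d : ℕ} (hc : 0 < c)
    (h : ∀ P, 1 ≤ P → c * (1 / P) ^ d ≤ Pe P) {a : ℝ} (ha : d < a) :
    ∀ᶠ P in atTop, -Real.log (Pe P) / Real.log P < a := by
  have h0 : Tendsto (fun P : ℝ => d - Real.log c / Real.log P) atTop (𝓝 (d - 0)) :=
    tendsto_const_nhds.sub (Real.tendsto_log_atTop.const_div_atTop _)
  rw [sub_zero] at h0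
  filter_upwards [h0.eventually_lt_const ha, eventually_gt_atTop 1] with P hP hP1
  refine lt_of_le_of_lt ?_ hP
  have hlog : 0 < Real.log P := Real.log_pos hP1
  have hP0 : 0 < P := by linarith
  have h1 := Real.log_le_log (by positivity) (h P hP1.le)
  rw [Real.log_mul hc.ne' (by positivity), Real.log_pow, one_div, Real.log_inv] at h1
  rw [div_le_iff₀ hlog, sub_mul, div_mul_cancel₀ _ hlog.ne']
  linarith

theorem eventually_lt_log_ratio {Pe : ℝ → ℝ} {K b : ℝ} (hpos : ∀ P, 1 ≤ P → 0 < Pe P)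
    (h : ∀ P, 1 ≤ P → P ^ b * Pe P ≤ K) {a : ℝ} (ha : a < b) :
    ∀ᶠ P in atTop, a < -Real.log (Pe P) / Real.log P := by
  have h0 : Tendsto (fun P : ℝ => b - Real.log K / Real.log P) atTop (𝓝 (b - 0)) :=
    tendsto_const_nhds.sub (Real.tendsto_log_atTop.const_div_atTop _)
  rw [sub_zero] at h0
  filter_upwards [h0.eventually_const_lt ha, eventually_gt_atTop 1] with P hP hP1
  refine lt_of_lt_of_le hP ?_
  have hlog : 0 < Real.log P := Real.log_pos hP1
  have hP0 : 0 < P := by linarith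
  have hPe := hpos P hP1.le
  have h1 := Real.log_le_log (by positivity) (h P hP1.le)
  rw [Real.log_mul (by positivity) hPe.ne', Real.log_rpow hP0] at h1
  rw [le_div_iff₀ hlog, sub_mul, div_mul_cancel₀ _ hlog.ne']
  linarith

theorem one_div_sqrt_mem {P : ℝ} (hP : 1 ≤ P) :
    0 ≤ 1 / Real.sqrt P ∧ 1 / Real.sqrt P ≤ 1 ∧ (1 / Real.sqrt P) ^ 2 = 1 / P := by
  refine ⟨by positivity, ?_, ?_⟩
  · rw [div_le_one (by positivity)]
    exact Real.one_le_sqrt.mpr hP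
  · rw [div_pow, Real.sq_sqrt (by linarith), one_pow]

variable {R L : ℕ} {u : Slot R → ℤ} {M : Matrix (Fin R) (Fin R) ℂ} {α : ℝ}
  {dec : ℝ → (Fin R → ℂ) → (Slot R → ℂ) → Fin L}

/-- No decoder has diversity order more than `R`. -/
theorem exists_le_errorProb (hR : 1 ≤ R) (hL : 2 ≤ L) (hM : IsGBH M) (hα₀ : 0 < α) (hα₁ : α < 1)
    (hdec : ∀ P : ℝ, 0 < P → IsMLDecoder u M (α * P) ((1 - α) * P / R) (dec P)) :
    ∃ c : ℝ, 0 < c ∧ ∀ P, 1 ≤ P →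
      c * (1 / P) ^ R ≤ blockErrorProb u M (α * P) ((1 - α) * P / R) (dec P) := by
  obtain ⟨r, rfl⟩ : ∃ r, R = r + 1 := ⟨R - 1, by omega⟩
  have hnm : (⟨0, by omega⟩ : Fin L) ≠ ⟨1, by omega⟩ := by simp
  -- Zero slopes turn the tube into a polydisc around `f = 0`, where any two messages are confused
  -- without rotation.
  obtain ⟨c, hc0, hc⟩ := exists_le_blockErrorProb u M hnm (z := 1) (by simp)
    (κ := fun _ : Fin r => 0) (by simp) (C := 8 * ((r + 1 : ℕ) : ℝ)) (by positivity)
  refine ⟨c, hc0, fun P hP => ?_⟩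
  obtain ⟨h0, h1, h2⟩ := one_div_sqrt_mem hP
  have h3 := hc (α * P) ((1 - α) * P / ((r + 1 : ℕ) : ℝ)) (1 / Real.sqrt P) (1 / Real.sqrt P)
    (dec P) (hdec P (by linarith)).measurable h0 h1 h0 h1 (fun x hx i => by
      refine norm_gain_mul_sub_le hR hM u (by simp) (a := 0) (by simp)
        (gain_mul_inv_sqrt_le hR hα₀ hα₁ hP) (fun j => ?_) i
      obtain ⟨hg, hf0, hf⟩ := hx
      have hgj := norm_mem_of_mem_closedBall (hg j)
      have hfj : ‖x.1 j‖ ≤ 1 / Real.sqrt P := by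
        rcases Fin.eq_zero_or_eq_succ j with rfl | ⟨j, rfl⟩
        · exact hf0
        · simpa using hf j
      rw [Pi.zero_apply, sub_zero, Pi.mul_apply, norm_mul, mul_comm]
      exact mul_le_mul hgj.2 hfj (norm_nonneg _) zero_le_two)
  rw [h2] at h3
  rw [pow_succ']
  exact h3

/-- If the condition on the exponents fails, some error event has probability of order at least
`P ^ (1 - R)`. -/
theorem exists_le_errorProb_of_gcd_ne_one (hR : 1 ≤ R) (hL : 2 ≤ L) (hM : IsGBH M) (hα₀ : 0 < α)
    (hα₁ : α < 1)
    (hdec : ∀ P : ℝ, 0 < P → IsMLDecoder u M (α * P) ((1 - α) * P / R) (dec P)) {i : Fin R}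
    (hi : Int.gcd (u (Sum.inl i) - u (Sum.inr i)) (L : ℤ) ≠ 1) :
    ∃ c : ℝ, 0 < c ∧ ∀ P, 1 ≤ P →
      c * (1 / P) ^ (R - 1) ≤ blockErrorProb u M (α * P) ((1 - α) * P / R) (dec P) := by
  obtain ⟨r, rfl⟩ : ∃ r, R = r + 1 := ⟨R - 1, by omega⟩
  obtain ⟨n, m, hnm, z, hz, ha⟩ := exists_codeword_mulVec_eq hL u hM hi
  set a : Fin (r + 1) → ℂ := fun j => star (M i j) with ha_def
  have ha1 : ∀ j, ‖a j‖ = 1 := fun j => by rw [ha_def, norm_star, norm_entry hM]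
  have ha0 : ∀ j, a j ≠ 0 := fun j => norm_ne_zero_iff.mp (by rw [ha1]; exact one_ne_zero)
  -- These slopes make `(f_j g_j)` proportional to `a` on the axis of the tube.
  obtain ⟨c, hc0, hc⟩ := exists_le_blockErrorProb u M hnm hz
    (κ := fun j : Fin r => a j.succ / a 0) (fun j => by rw [norm_div, ha1, ha1, div_one])
    (C := 8 * ((r + 1 : ℕ) : ℝ)) (by positivity)
  refine ⟨c, hc0, fun P hP => ?_⟩
  obtain ⟨h0, h1, h2⟩ := one_div_sqrt_mem hP
  -- Taking `ρ = 1` leaves `f_0` at unit scale, which saves one factor `1 / P`.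
  have h3 := hc (α * P) ((1 - α) * P / ((r + 1 : ℕ) : ℝ)) 1 (1 / Real.sqrt P)
    (dec P) (hdec P (by linarith)).measurable zero_le_one le_rfl h0 h1 (fun x hx i => by
      obtain ⟨hg, hf0, hf⟩ := hx
      refine norm_gain_mul_sub_le hR hM u hz (a := (x.2 0 * x.1 0 / a 0) • a)
        (by rw [Matrix.mulVec_smul, Matrix.mulVec_smul, ha, smul_comm])
        (gain_mul_inv_sqrt_le hR hα₀ hα₁ hP) (fun j => ?_) i
      have hgj := norm_mem_of_mem_closedBall (hg j)
      rcases Fin.eq_zero_or_eq_succ j with rfl | ⟨j, rfl⟩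
      · rw [Pi.mul_apply, Pi.smul_apply, smul_eq_mul, div_mul_cancel₀ _ (ha0 0), mul_comm, sub_self,
          norm_zero]
        positivity
      · have hgj0 : x.2 j.succ ≠ 0 := norm_pos_iff.mp (by linarith)
        have e : (x.1 * x.2) j.succ - ((x.2 0 * x.1 0 / a 0) • a) j.succ =
            x.2 j.succ * (x.1 j.succ - a j.succ / a 0 * (x.2 0 / x.2 j.succ) * x.1 0) := by
          rw [Pi.mul_apply, Pi.smul_apply, smul_eq_mul]
          have := ha0 0
          field_simp
        rw [e, norm_mul]
        exact mul_le_mul hgj.2 (hf j) (norm_nonneg _) zero_le_two)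
  rw [h2, one_pow, one_mul] at h3
  exact h3

theorem exists_errorProb_le_rpow (hR : 1 ≤ R) (hL : 2 ≤ L) (hM : IsGBH M) (hα₀ : 0 < α)
    (hα₁ : α < 1)
    (hdec : ∀ P : ℝ, 0 < P → IsMLDecoder u M (α * P) ((1 - α) * P / R) (dec P))
    (hu : ∀ i : Fin R, Int.gcd (u (Sum.inl i) - u (Sum.inr i)) (L : ℤ) = 1)
    {t : ℝ} (ht0 : 0 < t) (ht1 : t < 1) :
    ∃ K : ℝ, ∀ P, 1 ≤ P →
      P ^ (t * R) * blockErrorProb u M (α * P) ((1 - α) * P / R) (dec P) ≤ K := by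
  have hR' : (0 : ℝ) < R := by exact_mod_cast hR
  have hL' : (0 : ℝ) < L := by positivity
  have h1α : 0 < 1 - α := by linarith
  have hκ : 0 < α * (1 - α) := mul_pos hα₀ h1α
  obtain ⟨K, -, hK⟩ := exists_errorProb_le u hM (fun k m => det_fromCols_ne_zero hR hL u hM hu)
    -- `β` bounds `P₂ / (1 + P₁)` uniformly in `P`; the choice `s = 2t` turns `gain ^ s` into order
    -- `P ^ t`.
    (β := (1 - α) / (R * α)) (s := 2 * t) (by positivity) (by linarith) (by linarith)
  refine ⟨K / ((α * (1 - α)) ^ t) ^ R, fun P hP => ?_⟩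
  have hP0 : 0 < P := by linarith
  rw [le_div_iff₀ (by positivity)]
  have hβ : (1 - α) * P / R / (1 + α * P) ≤ (1 - α) / (R * α) := by
    rw [div_div, div_le_div_iff₀ (by positivity) (by positivity)]
    have : 0 ≤ (1 - α) * R := by positivity
    nlinarith
  have hg : ((α * (1 - α)) ^ t) ^ R * P ^ (t * R) ≤
      (gain R (α * P) ((1 - α) * P / R) ^ (2 * t)) ^ R := by
    rw [Real.rpow_mul hP0.le, Real.rpow_natCast, ← mul_pow, ← Real.mul_rpow hκ.le hP0.le,
      Real.rpow_mul (gain_nonneg _ _ _), Real.rpow_two]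
    have := le_gain_sq hR hα₀ hα₁ hP
    gcongr
  have hk : ∀ k : Fin L, ((α * (1 - α)) ^ t) ^ R * P ^ (t * R) *
      (channelLaw R).real {ω | dec P ω.2.1
        (received u M (α * P) ((1 - α) * P / R) k ω) ≠ k} ≤ K := fun k =>
    (mul_le_mul_of_nonneg_right hg measureReal_nonneg).trans
      (hK _ _ (by positivity) (by positivity) hβ (dec P) (hdec P hP0) k)
  have hsum := Finset.sum_le_sum fun k (_ : k ∈ Finset.univ) => hk k
  rw [← Finset.mul_sum, Finset.sum_const, Finset.card_univ, Fintype.card_fin, nsmul_eq_mul] at hsum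
  have h4 := mul_le_mul_of_nonneg_left hsum (by positivity : 0 ≤ 1 / (L : ℝ))
  rw [← mul_assoc (1 / (L : ℝ)) L K, one_div_mul_cancel hL'.ne', one_mul] at h4
  refine le_trans (le_of_eq ?_) h4
  rw [blockErrorProb]
  ring

theorem hasDiversityOrder_iff (hR : 1 ≤ R) (hL : 2 ≤ L) (hM : IsGBH M) (hα₀ : 0 < α)
    (hα₁ : α < 1)
    (hdec : ∀ P : ℝ, 0 < P → IsMLDecoder u M (α * P) ((1 - α) * P / R) (dec P)) :
    HasDiversityOrder
        (fun P => blockErrorProb u M (α * P) ((1 - α) * P / R) (dec P)) R ↔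
      ∀ i : Fin R, Int.gcd (u (Sum.inl i) - u (Sum.inr i)) (L : ℤ) = 1 := by
  have hR' : (0 : ℝ) < R := by exact_mod_cast hR
  constructor
  · intro h i
    by_contra hi
    obtain ⟨c, hc0, hc⟩ := exists_le_errorProb_of_gcd_ne_one hR hL hM hα₀ hα₁ hdec hi
    have hlt : ((R - 1 : ℕ) : ℝ) < R - 1 / 2 := by
      rw [Nat.cast_sub hR]
      norm_num
    have h1 := eventually_log_ratio_le hc0 hc hlt
    have h2 := (tendsto_order.mp h).1 (R - 1 / 2) (by linarith)
    obtain ⟨P, hP1, hP2⟩ := (h1.and h2).exists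
    linarith
  · intro hu
    obtain ⟨c, hc0, hc⟩ := exists_le_errorProb hR hL hM hα₀ hα₁ hdec
    refine tendsto_order.mpr ⟨fun a ha => ?_, fun a ha => eventually_log_ratio_le hc0 hc ha⟩
    -- The midpoint of `a / R` and `1` gives `a < t R` with `t < 1`; the maximum with `1 / 2` keeps
    -- `t` positive even for negative `a`.
    have ht1 : max (1 / 2) ((1 + a / R) / 2) < 1 := by
      have := (div_lt_one hR').mpr ha
      exact max_lt (by norm_num) (by linarith)
    have ht0 : 0 < max (1 / 2 : ℝ) ((1 + a / R) / 2) := lt_max_of_lt_left (by norm_num)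
    obtain ⟨K, hK⟩ := exists_errorProb_le_rpow hR hL hM hα₀ hα₁ hdec hu ht0 ht1
    refine eventually_lt_log_ratio (fun P hP => ?_) hK ?_
    · exact lt_of_lt_of_le (by positivity) (hc P hP)
    · rw [← div_lt_iff₀ hR']
      have := (div_lt_one hR').mpr ha
      exact lt_max_of_lt_right (by linarith)

end

end RelayNetwork

theorem mainTheorem3 (R L : ℕ) (hR : 1 ≤ R) (hL : 2 ≤ L)
    (u : RelayNetwork.Slot R → ℤ)
    (M : Matrix (Fin R) (Fin R) ℂ) (hM : RelayNetwork.IsGBH M)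
    (α : ℝ) (hα₀ : 0 < α) (hα₁ : α < 1)
    (dec : ℝ → (Fin R → ℂ) → (RelayNetwork.Slot R → ℂ) → Fin L)
    (hdec : ∀ P : ℝ, 0 < P →
      RelayNetwork.IsMLDecoder u M (α * P) ((1 - α) * P / R) (dec P)) :
    (RelayNetwork.HasDiversityOrder
        (fun P => RelayNetwork.blockErrorProb u M (α * P) ((1 - α) * P / R) (dec P)) R ↔
      ∀ i : Fin R, Int.gcd (u (Sum.inl i) - u (Sum.inr i)) (L : ℤ) = 1) ∧
    (RelayNetwork.MeetsDeterminantCriterion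
        (fun k : Fin L => RelayNetwork.codeword u M k) ↔
      ∀ i : Fin R, Int.gcd (u (Sum.inl i) - u (Sum.inr i)) (L : ℤ) = 1) :=
  ⟨RelayNetwork.hasDiversityOrder_iff hR hL hM hα₀ hα₁ hdec,
    RelayNetwork.meetsDeterminantCriterion_iff hR hL u hM⟩
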